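/- Let $n_1,n_2,m\in\mathbb N$, $n=\min\{n_1,n_2\}$. On $\mathbb R^{n_1\times n_2}$ let $\langle A,B\rangle=\sum_{i,j}A_{ij}B_{ij}$, let $\|\cdot\|_F$ be the Frobenius norm, let $\sigma_1(X)\ge\sigma_2(X)\ge\cdots\ge\sigma_n(X)\ge 0$ be the singular values of $X$, let $\|X_{i,:}\|_2$ be the Euclidean norm of its $i$-th row and let $\rho_j(X)$ be the $j$-th largest of the row norms (with multiplicity); put $\sigma_j(X)=0$ for $j>n$ and $\rho_j(X)=0$ for $j>n_1$. For $\tau>0$ let \[ f_\tau(t)=\begin{cases}\tfrac12\tau^2\log(e\,t^2/\tau^2),&|t|>\tau,\\ \tfrac12t^2,&|t|\le\tau,\end{cases} \qquad f_0:=0=\lim_{\tau\downarrow0}f_\tau , \] \[ \mathcal F_{\mathrm{lr},\varepsilon}(X)=\sum_{i=1}^{n}f_\varepsilon(\sigma_i(X)),\qquad \mathcal F_{\mathrm{sp},\delta}(X)=\sum_{i=1}^{n_1}f_\delta(\|X_{i,:}\|_2),\qquad \mathcal F_{\varepsilon,\delta}=\mathcal F_{\mathrm{lr},\varepsilon}+\mathcal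 F_{\mathrm{sp},\delta}. \] For $X\in\mathbb R^{n_1\times n_2}$ and $\varepsilon,\delta>0$ let $U\in\mathbb R^{n_1\times n_1}$ and $V\in\mathbb R^{n_2\times n_2}$ be orthogonal matrices whose leading columns are left and right singular vectors of $X$ belonging to the singular values $\sigma_i(X)>\varepsilon$ (in non-increasing order), the remaining columns being an arbitrary orthonormal completion. Define \[ W^{\mathrm{lr}}_{X,\varepsilon}(Z)=U\Sigma_{n_1}^{-1}U^{\top}Z\,V\Sigma_{n_2}^{-1}V^{\top},\qquad \Sigma_d=\operatorname{diag}\big(\max(\sigma_i(X)/\varepsilon,1)\big)_{i=1}^{d}, \] \[ W^{\mathrm{sp}}_{X,\delta}=\operatorname{diag}\Big(\max\big(\|X_{i,:}\|_2^2/\delta^2,1\big)^{-1}\Big)_{i=1}^{n_1},\qquad W_{X,\varepsilon,\delta}(Z)=W^{\mathrm{lr}}_{X,\varepsilon}(Z)+W^{\mathrm{sp}}_{X,\delta}Z, \] and the quadratic models \[ \mathcal Q_{\mathrm{lr},\varepsilon}(Z|X)=\mathcal F_{\mathrm{lr},\varepsilon}(X)+\langle\nabla\mathcal F_{\mathrm{lr},\varepsilon}(X),Z-X\rangle+\tfrac12\langle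 Z-X,W^{\mathrm{lr}}_{X,\varepsilon}(Z-X)\rangle, \] \[ \mathcal Q_{\mathrm{sp},\delta}(Z|X)=\mathcal F_{\mathrm{sp},\delta}(X)+\langle\nabla\mathcal F_{\mathrm{sp},\delta}(X),Z-X\rangle+\tfrac12\langle Z-X,W^{\mathrm{sp}}_{X,\delta}(Z-X)\rangle . \] Let $\mathcal A:\mathbb R^{n_1\times n_2}\to\mathbb R^m$ be any linear map, $y\in\mathbb R^m$, and $\tilde r,\tilde s\in\mathbb N_0$. Let $(X^{(k)})_{k\ge1}$, $(\varepsilon_k)_{k\ge1}$, $(\delta_k)_{k\ge1}$ be produced by the IRLS algorithm: $X^{(1)}$ minimizes $\|X\|_F^2$ subject to $\mathcal A(X)=y$; $\varepsilon_1=\sigma_{\tilde r+1}(X^{(1)})$, $\delta_1=\rho_{\tilde s+1}(X^{(1)})$; and for $k\ge1$, as long as $\varepsilon_k,\delta_k>0$ (so that the weight operator is defined; otherwise the algorithm stops at iteration $k$), \[ X^{(k+1)}\in\operatorname*{arg\,min}_{X:\,\mathcal A(X)=y}\langle X,W_{X^{(k)},\varepsilon_k,\delta_k}(X)\rangle,\quad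 \varepsilon_{k+1}=\min\big(\varepsilon_k,\sigma_{\tilde r+1}(X^{(k+1)})\big),\quad \delta_{k+1}=\min\big(\delta_k,\rho_{\tilde s+1}(X^{(k+1)})\big). \] Then the following hold. 1. For every iteration $k\ge1$ with $\varepsilon_k,\delta_k>0$, the functions $\mathcal F_{\mathrm{lr},\varepsilon_k}$ and $\mathcal F_{\mathrm{sp},\delta_k}$ are differentiable at $X^{(k)}$ (so that the quadratic models are well defined), and for all $Z\in\mathbb R^{n_1\times n_2}$ \[ \mathcal F_{\varepsilon_k,\delta_k}(Z)\le\mathcal Q_{\mathrm{lr},\varepsilon_k}(Z|X^{(k)})+\mathcal Q_{\mathrm{sp},\delta_k}(Z|X^{(k)}). \] 2. The sequence $\mathcal F_{\varepsilon_k,\delta_k}(X^{(k)})$ is non-increasing: $\mathcal F_{\varepsilon_{k+1},\delta_{k+1}}(X^{(k+1)})\le\mathcal F_{\varepsilon_k,\delta_k}(X^{(k)})$ for every $k\ge1$ for which iteration $k+1$ is performed, i.e. with $\varepsilon_k,\delta_k>0$. 3. If the algorithm does not stop and $\bar\varepsilon:=\lim_k\varepsilon_k>0$ and $\bar\delta:=\lim_k\delta_k>0$,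 then $\lim_{k\to\infty}\|X^{(k)}-X^{(k+1)}\|_F=0$, and every accumulation point $\bar X$ of $(X^{(k)})_{k\ge1}$ is a stationary point of $\min_{X:\,\mathcal A(X)=y}\mathcal F_{\bar\varepsilon,\bar\delta}(X)$, i.e. $\mathcal A(\bar X)=y$, $\mathcal F_{\bar\varepsilon,\bar\delta}$ is differentiable at $\bar X$, and $\langle\nabla\mathcal F_{\bar\varepsilon,\bar\delta}(\bar X),\Xi\rangle=0$ for all $\Xi\in\ker\mathcal A$. -/

import Mathlib

open Filter Topology
open scoped Matrix Matrix.Norms.Frobenius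

namespace IRLS

/-- Frobenius inner product `⟨A, B⟩ = ∑ᵢⱼ Aᵢⱼ Bᵢⱼ`. The norm on matrices is the Frobenius norm
throughout. -/
def frobInner {n₁ n₂ : ℕ} (A B : Matrix (Fin n₁) (Fin n₂) ℝ) : ℝ :=
  ∑ i, ∑ j, A i j * B i j

/-- Singular values in non-increasing order, indexed from `0` (so `sing X r` is the `(r+1)`-st
singular value), and `0` for indices `≥ min n₁ n₂`. -/
noncomputable def sing {n₁ n₂ : ℕ} (X : Matrix (Fin n₁) (Fin n₂) ℝ) (i : ℕ) : ℝ :=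
  (Matrix.toEuclideanLin X).singularValues i

/-- Euclidean norm of the `i`-th row. -/
noncomputable def rowNorm {n₁ n₂ : ℕ} (X : Matrix (Fin n₁) (Fin n₂) ℝ) (i : Fin n₁) : ℝ :=
  ‖WithLp.toLp 2 (X i)‖

/-- The `(s+1)`-st largest Euclidean row norm (with multiplicity); `0` if `s ≥ n₁`. -/
noncomputable def rowNormSorted {n₁ n₂ : ℕ} (X : Matrix (Fin n₁) (Fin n₂) ℝ) (s : ℕ) : ℝ :=
  (((Finset.univ : Finset (Fin n₁)).val.map (rowNorm X)).sort (· ≥ ·)).getD s 0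

/-- The scalar smoothed logarithm: quadratic for `|t| ≤ τ`, logarithmic for `|t| > τ`. For `τ = 0`
it is identically `0`, which is the pointwise limit as `τ → 0`. -/
noncomputable def fSmooth (τ t : ℝ) : ℝ :=
  if τ < |t| then (1 / 2) * τ ^ 2 * Real.log (Real.exp 1 * t ^ 2 / τ ^ 2) else (1 / 2) * t ^ 2

/-- Smoothed log-determinant objective. -/
noncomputable def Flr {n₁ n₂ : ℕ} (ε : ℝ) (X : Matrix (Fin n₁) (Fin n₂) ℝ) : ℝ :=
  ∑ i ∈ Finset.range (min n₁ n₂), fSmooth ε (sing X i)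

/-- Smoothed sum of logarithmic row norms. -/
noncomputable def Fsp {n₁ n₂ : ℕ} (δ : ℝ) (X : Matrix (Fin n₁) (Fin n₂) ℝ) : ℝ :=
  ∑ i, fSmooth δ (rowNorm X i)

/-- The smoothed logarithmic surrogate objective. -/
noncomputable def F {n₁ n₂ : ℕ} (ε δ : ℝ) (X : Matrix (Fin n₁) (Fin n₂) ℝ) : ℝ :=
  Flr ε X + Fsp δ X

/-- The gradient with respect to the Frobenius inner product: the matrix of partial derivatives. -/
noncomputable def matGrad {n₁ n₂ : ℕ} (G : Matrix (Fin n₁) (Fin n₂) ℝ → ℝ)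
    (X : Matrix (Fin n₁) (Fin n₂) ℝ) : Matrix (Fin n₁) (Fin n₂) ℝ :=
  Matrix.of fun i j => fderiv ℝ G X (Matrix.single i j 1)

/-- `U` and `V` are orthogonal matrices whose leading columns are left and right singular vectors
of `X` for the singular values exceeding `ε` (in non-increasing order); the remaining columns are
an arbitrary orthonormal completion. -/
structure IsSingularBases {n₁ n₂ : ℕ} (X : Matrix (Fin n₁) (Fin n₂) ℝ) (ε : ℝ)
    (U : Matrix (Fin n₁) (Fin n₁) ℝ) (V : Matrix (Fin n₂) (Fin n₂) ℝ) : Prop where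
  left_orthogonal : U ∈ Matrix.orthogonalGroup (Fin n₁) ℝ
  right_orthogonal : V ∈ Matrix.orthogonalGroup (Fin n₂) ℝ
  mul_right : ∀ (i : Fin n₁) (j : Fin n₂), (i : ℕ) = j → ε < sing X i →
    X *ᵥ V.col j = sing X i • U.col i
  mul_left : ∀ (i : Fin n₁) (j : Fin n₂), (i : ℕ) = j → ε < sing X i →
    Xᵀ *ᵥ U.col i = sing X i • V.col j

/-- The `n × n` diagonal matrix with entries `max(σᵢ(X)/ε, 1)⁻¹`; the entries beyond
`min n₁ n₂` are `1`. -/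
noncomputable def sigmaInv {n₁ n₂ : ℕ} (X : Matrix (Fin n₁) (Fin n₂) ℝ) (ε : ℝ) (n : ℕ) :
    Matrix (Fin n) (Fin n) ℝ :=
  Matrix.diagonal fun i => (max (sing X i / ε) 1)⁻¹

/-- Low-rank promoting part of the weight operator. -/
noncomputable def Wlr {n₁ n₂ : ℕ} (X : Matrix (Fin n₁) (Fin n₂) ℝ) (ε : ℝ)
    (U : Matrix (Fin n₁) (Fin n₁) ℝ) (V : Matrix (Fin n₂) (Fin n₂) ℝ)
    (Z : Matrix (Fin n₁) (Fin n₂) ℝ) : Matrix (Fin n₁) (Fin n₂) ℝ :=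
  U * sigmaInv X ε n₁ * Uᵀ * Z * V * sigmaInv X ε n₂ * Vᵀ

/-- Sparsity promoting part of the weight operator, a diagonal matrix. -/
noncomputable def Wsp {n₁ n₂ : ℕ} (X : Matrix (Fin n₁) (Fin n₂) ℝ) (δ : ℝ) :
    Matrix (Fin n₁) (Fin n₁) ℝ :=
  Matrix.diagonal fun i => (max (rowNorm X i ^ 2 / δ ^ 2) 1)⁻¹

/-- The weight operator. -/
noncomputable def W {n₁ n₂ : ℕ} (X : Matrix (Fin n₁) (Fin n₂) ℝ) (ε δ : ℝ)
    (U : Matrix (Fin n₁) (Fin n₁) ℝ) (V : Matrix (Fin n₂) (Fin n₂) ℝ)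
    (Z : Matrix (Fin n₁) (Fin n₂) ℝ) : Matrix (Fin n₁) (Fin n₂) ℝ :=
  Wlr X ε U V Z + Wsp X δ * Z

/-- The quadratic model of `Flr ε` at `X`, evaluated at `Z`. -/
noncomputable def Qlr {n₁ n₂ : ℕ} (X : Matrix (Fin n₁) (Fin n₂) ℝ) (ε : ℝ)
    (U : Matrix (Fin n₁) (Fin n₁) ℝ) (V : Matrix (Fin n₂) (Fin n₂) ℝ)
    (Z : Matrix (Fin n₁) (Fin n₂) ℝ) : ℝ :=
  Flr ε X + frobInner (matGrad (Flr ε) X) (Z - X)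
    + (1 / 2) * frobInner (Z - X) (Wlr X ε U V (Z - X))

/-- The quadratic model of `Fsp δ` at `X`, evaluated at `Z`. -/
noncomputable def Qsp {n₁ n₂ : ℕ} (X : Matrix (Fin n₁) (Fin n₂) ℝ) (δ : ℝ)
    (Z : Matrix (Fin n₁) (Fin n₂) ℝ) : ℝ :=
  Fsp δ X + frobInner (matGrad (Fsp δ) X) (Z - X)
    + (1 / 2) * frobInner (Z - X) (Wsp X δ * (Z - X))

/-- `X` solves the weighted least squares problem `min ⟨Z, T(Z)⟩` subject to `𝒜(Z) = y`. -/
def IsWLSSolution {n₁ n₂ m : ℕ} (A : Matrix (Fin n₁) (Fin n₂) ℝ →ₗ[ℝ] (Fin m → ℝ))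
    (y : Fin m → ℝ) (T : Matrix (Fin n₁) (Fin n₂) ℝ → Matrix (Fin n₁) (Fin n₂) ℝ)
    (X : Matrix (Fin n₁) (Fin n₂) ℝ) : Prop :=
  A X = y ∧ ∀ Z, A Z = y → frobInner X (T X) ≤ frobInner Z (T Z)

/-- Iterates `X k`, smoothing parameters `ε k`, `δ k` and singular bases `U k`, `V k` (`k ≥ 1`) of
the algorithm with rank and sparsity estimates `r` and `s`. The first iterate is computed with the
identity weight operator and `ε₀ = δ₀ = ∞`. Iteration `k + 1` is performed with the weight operator
of iteration `k`, which exists only if `ε k > 0` and `δ k > 0`; otherwise the algorithm has stopped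
at iteration `k`, and (as `ε` and `δ` are non-increasing and non-negative) one of the smoothing
parameters is zero from then on, while the later `X k` are irrelevant. -/
structure IsIRLSSequence {n₁ n₂ m : ℕ} (A : Matrix (Fin n₁) (Fin n₂) ℝ →ₗ[ℝ] (Fin m → ℝ))
    (y : Fin m → ℝ) (r s : ℕ) (X : ℕ → Matrix (Fin n₁) (Fin n₂) ℝ) (ε δ : ℕ → ℝ)
    (U : ℕ → Matrix (Fin n₁) (Fin n₁) ℝ) (V : ℕ → Matrix (Fin n₂) (Fin n₂) ℝ) : Prop where
  wls_one : IsWLSSolution A y (fun Z => Z) (X 1)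
  eps_one : ε 1 = sing (X 1) r
  delta_one : δ 1 = rowNormSorted (X 1) s
  bases : ∀ k, 1 ≤ k → 0 < ε k → 0 < δ k → IsSingularBases (X k) (ε k) (U k) (V k)
  wls_succ : ∀ k, 1 ≤ k → 0 < ε k → 0 < δ k →
    IsWLSSolution A y (W (X k) (ε k) (δ k) (U k) (V k)) (X (k + 1))
  eps_succ : ∀ k, 1 ≤ k → ε (k + 1) = min (ε k) (sing (X (k + 1)) r)
  delta_succ : ∀ k, 1 ≤ k → δ (k + 1) = min (δ k) (rowNormSorted (X (k + 1)) s)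

/-- `X` is a stationary point of `min G(Z)` subject to `𝒜(Z) = y`: it is feasible, `G` is
differentiable at `X`, and the gradient is orthogonal to the kernel of `𝒜`. -/
def IsStationaryPoint {n₁ n₂ m : ℕ} (A : Matrix (Fin n₁) (Fin n₂) ℝ →ₗ[ℝ] (Fin m → ℝ))
    (y : Fin m → ℝ) (G : Matrix (Fin n₁) (Fin n₂) ℝ → ℝ)
    (X : Matrix (Fin n₁) (Fin n₂) ℝ) : Prop :=
  A X = y ∧ DifferentiableAt ℝ G X ∧
    ∀ Ξ : Matrix (Fin n₁) (Fin n₂) ℝ, A Ξ = 0 → frobInner (matGrad G X) Ξ = 0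

end IRLS

/-! The iteration is a majorize-minimize scheme. For fixed `t ≥ 0` and `τ > 0`, `fSmooth τ t` is the
minimum over `0 < μ ≤ 1` of `μ t² / 2 - τ² log μ / 2`, attained at `μ = wt τ t ^ 2` (`fSmooth_le`,
`fSmooth_eq_wt`). Applied row by row this bounds `Fsp` by a quadratic that is exact at the current
iterate.

For `Flr` the matrix analogue replaces `μ` by a pair of contractions and `log μ` by log-determinants
(`Flr_le`). Hadamard's inequality gives a one-sided version, and using it once on each side of `Z`
gives the two-sided one. The square roots of the weights of `X` are contractions for which the bound
is exact at `Z = X`, so `W` majorizes although `U` and `V` are singular bases only above the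
threshold.

Differentiability needs a bound from below. A scalar tangent parabola (`le_fSmooth`), averaged over
squared entries of orthogonal matrices, gives a quadratic minorant of `Flr` with the same linear
part as the majorant (`IsSVD.le_Flr`); for `Fsp`, Cauchy-Schwarz in each row suffices. A function
squeezed between the two is differentiable, and the majorant alone then identifies its gradient as
the weight operator applied to `X`.

Optimality of the weighted least squares step turns majorization into a decrease by half the
`W`-energy of the step. Bounded objective values bound the row norms, hence bound the sparsity
weights away from zero, so the steps tend to zero. Stationarity comes from the limit of the
majorization inequality itself; neither the weights nor the singular bases need to converge. -/

namespace IRLS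

/-! ### The scalar function `fSmooth` -/

/-- The minimiser of `h ↦ h ^ 2 * t ^ 2 / 2 - τ ^ 2 * log h` over `(0, 1]` for `t ≥ 0`. -/
noncomputable def wt (τ t : ℝ) : ℝ := (max (t / τ) 1)⁻¹

theorem wt_pos (τ t : ℝ) : 0 < wt τ t :=
  inv_pos.2 (lt_of_lt_of_le one_pos (le_max_right _ _))

theorem wt_le_one (τ t : ℝ) : wt τ t ≤ 1 :=
  inv_le_one_of_one_le₀ (le_max_right _ _)

theorem wt_of_le {τ t : ℝ} (hτ : 0 < τ) (h : t ≤ τ) : wt τ t = 1 := by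
  rw [wt, max_eq_right ((div_le_one hτ).2 h), inv_one]

theorem wt_of_lt {τ t : ℝ} (hτ : 0 < τ) (h : τ < t) : wt τ t = τ / t := by
  rw [wt, max_eq_left ((one_le_div hτ).2 h.le), inv_div]

theorem fSmooth_of_le {τ t : ℝ} (ht : 0 ≤ t) (h : t ≤ τ) : fSmooth τ t = 1 / 2 * t ^ 2 := by
  rw [fSmooth, if_neg (by rw [abs_of_nonneg ht]; exact h.not_gt)]

theorem fSmooth_of_lt {τ t : ℝ} (hτ : 0 < τ) (h : τ < t) :
    fSmooth τ t = 1 / 2 * τ ^ 2 + τ ^ 2 * Real.log (t / τ) := by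
  have ht : 0 < t := hτ.trans h
  rw [fSmooth, if_pos (by rwa [abs_of_pos ht]), mul_div_assoc, ← div_pow,
    Real.log_mul (Real.exp_ne_zero _) (by positivity), Real.log_exp, Real.log_pow]
  push_cast
  ring

@[simp]
theorem fSmooth_apply_zero (τ : ℝ) : fSmooth τ 0 = 0 := by
  simp [fSmooth]

theorem fSmooth_zero_left (t : ℝ) : fSmooth 0 t = 0 := by
  by_cases h : t = 0 <;> simp [fSmooth, h]

theorem fSmooth_eq_wt {τ t : ℝ} (hτ : 0 < τ) (ht : 0 ≤ t) :
    fSmooth τ t = 1 / 2 * wt τ t ^ 2 * t ^ 2 - τ ^ 2 * Real.log (wt τ t) := by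
  rcases le_or_gt t τ with h | h
  · rw [wt_of_le hτ h, fSmooth_of_le ht h]; simp
  · have ht' : 0 < t := hτ.trans h
    rw [wt_of_lt hτ h, fSmooth_of_lt hτ h, ← inv_div t τ, Real.log_inv]
    field_simp
    ring

/-- Both cases are `log x ≤ x - 1`, at `x = μ` below the threshold and at `x = μ (t / τ)²` above it.
By `fSmooth_eq_wt` equality holds at `μ = wt τ t ^ 2`; all the majorizations rest on this pair. -/
theorem fSmooth_le {τ t μ : ℝ} (hτ : 0 < τ) (ht : 0 ≤ t) (hμ : 0 < μ) (hμ1 : μ ≤ 1) :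
    fSmooth τ t ≤ 1 / 2 * μ * t ^ 2 - 1 / 2 * τ ^ 2 * Real.log μ := by
  rcases le_or_gt t τ with h | h
  · rw [fSmooth_of_le ht h]
    have h1 := Real.log_le_sub_one_of_pos hμ
    have h2 : t ^ 2 ≤ τ ^ 2 := by gcongr
    nlinarith [mul_nonneg (sub_nonneg.2 h2) (sub_nonneg.2 hμ1),
      mul_le_mul_of_nonneg_left h1 (sq_nonneg τ)]
  · have ht' : 0 < t := hτ.trans h
    rw [fSmooth_of_lt hτ h]
    have hx : 0 < μ * (t / τ) ^ 2 := by positivity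
    have h1 := Real.log_le_sub_one_of_pos hx
    rw [Real.log_mul hμ.ne' (by positivity), Real.log_pow] at h1
    have h2 := mul_le_mul_of_nonneg_left h1 (sq_nonneg τ)
    have h3 : τ ^ 2 * (μ * (t / τ) ^ 2 - 1) = μ * t ^ 2 - τ ^ 2 := by field_simp
    rw [h3] at h2
    push_cast at h2
    nlinarith

theorem fSmooth_nonneg {τ t : ℝ} (hτ : 0 ≤ τ) (ht : 0 ≤ t) : 0 ≤ fSmooth τ t := by
  rcases hτ.eq_or_lt with rfl | hτ
  · rw [fSmooth_zero_left]
  · rw [fSmooth_eq_wt hτ ht]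
    have := Real.log_nonpos (wt_pos τ t).le (wt_le_one τ t)
    nlinarith [sq_nonneg (wt τ t * t), mul_nonneg (sq_nonneg τ) (neg_nonneg.2 this)]

/-- The optimal weight for `τ'` is a competitor in the variational formula for `τ`, and its
logarithm is nonpositive. -/
theorem fSmooth_mono {τ τ' t : ℝ} (hτ : 0 ≤ τ) (h : τ ≤ τ') (ht : 0 ≤ t) :
    fSmooth τ t ≤ fSmooth τ' t := by
  rcases hτ.eq_or_lt with rfl | hτ
  · rw [fSmooth_zero_left]; exact fSmooth_nonneg h ht
  · rw [fSmooth_eq_wt (hτ.trans_le h) ht]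
    have hw := wt_pos τ' t
    have h1 := fSmooth_le hτ ht (pow_pos hw 2) (pow_le_one₀ hw.le (wt_le_one τ' t))
    rw [Real.log_pow] at h1
    push_cast at h1
    have h2 := Real.log_nonpos hw.le (wt_le_one τ' t)
    have h3 : τ ^ 2 ≤ τ' ^ 2 := by gcongr
    nlinarith [mul_nonneg (sub_nonneg.2 h3) (neg_nonneg.2 h2)]

/-- `fSmooth τ` lies above its tangent parabolas of curvature `-2`. -/
theorem le_fSmooth {τ σ t : ℝ} (hτ : 0 < τ) (hσ : 0 ≤ σ) (ht : 0 ≤ t) :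
    fSmooth τ σ + wt τ σ ^ 2 * σ * (t - σ) - (t - σ) ^ 2 ≤ fSmooth τ t := by
  -- The coefficient `wt τ σ ^ 2 * σ` is the slope of `fSmooth τ` at `σ`: it is `σ` below the
  -- threshold and `τ² / σ` above it.
  rcases le_or_gt σ τ with h | h <;> rcases le_or_gt t τ with h' | h'
  · rw [fSmooth_of_le hσ h, fSmooth_of_le ht h', wt_of_le hτ h]
    nlinarith [sq_nonneg (t - σ)]
  · rw [fSmooth_of_le hσ h, fSmooth_of_lt hτ h', wt_of_le hτ h]
    have ht' : 0 < t := hτ.trans h'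
    have h1 := mul_le_mul_of_nonneg_left (Real.one_sub_inv_le_log_of_pos (div_pos ht' hτ))
      (sq_nonneg τ)
    rw [inv_div] at h1
    have h2 : (t - τ) * (τ - (t - τ)) ≤ τ ^ 2 * (1 - τ / t) := by
      rw [← sub_nonneg]
      have : τ ^ 2 * (1 - τ / t) - (t - τ) * (τ - (t - τ)) = (t - τ) ^ 2 * (t - τ) / t := by
        field_simp; ring
      rw [this]
      have := sub_pos.2 h'
      positivity
    nlinarith [mul_nonneg (sub_nonneg.2 h) (sub_nonneg.2 h'.le), sq_nonneg (τ - σ)]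
  · rw [fSmooth_of_lt hτ h, fSmooth_of_le ht h', wt_of_lt hτ h]
    have hσ' : 0 < σ := hτ.trans h
    have h1 := mul_le_mul_of_nonneg_left (Real.log_le_sub_one_of_pos (div_pos hσ' hτ))
      (sq_nonneg τ)
    have h3 : τ ^ 2 * (σ / τ - 1) = τ * (σ - τ) := by field_simp
    have h2 : (τ / σ) ^ 2 * σ * (σ - t) = τ ^ 2 / σ * (σ - t) := by field_simp
    have h4 : (2 * τ - σ) * (σ - t) ≤ τ ^ 2 / σ * (σ - t) := by
      refine mul_le_mul_of_nonneg_right ?_ (by linarith)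
      rw [le_div_iff₀ hσ']
      nlinarith [sq_nonneg (τ - σ)]
    nlinarith [mul_nonneg (sub_nonneg.2 h') (sub_nonneg.2 h.le), sq_nonneg (τ - t)]
  · rw [fSmooth_of_lt hτ h, fSmooth_of_lt hτ h', wt_of_lt hτ h]
    have hσ' : 0 < σ := hτ.trans h
    have ht' : 0 < t := hτ.trans h'
    have h1 := mul_le_mul_of_nonneg_left (Real.one_sub_inv_le_log_of_pos (div_pos ht' hσ'))
      (sq_nonneg τ)
    rw [inv_div, Real.log_div ht'.ne' hσ'.ne'] at h1
    rw [Real.log_div ht'.ne' hτ.ne', Real.log_div hσ'.ne' hτ.ne']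
    have h2 : (τ / σ) ^ 2 * σ * (t - σ) - (t - σ) ^ 2 ≤ τ ^ 2 * (1 - σ / t) := by
      rw [← sub_nonneg]
      have : τ ^ 2 * (1 - σ / t) - ((τ / σ) ^ 2 * σ * (t - σ) - (t - σ) ^ 2)
          = (t - σ) ^ 2 * (t * σ - τ ^ 2) / (t * σ) := by
        field_simp; ring
      rw [this]
      have : 0 ≤ t * σ - τ ^ 2 := by nlinarith
      positivity
    linarith

/-- Turns a bound on the objective into a bound on the reciprocal sparsity weights: above the
threshold `2 f / τ²` equals `1 + log (t² / τ²)`. -/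
theorem max_sq_div_le_exp {τ t : ℝ} (hτ : 0 < τ) (ht : 0 ≤ t) :
    max (t ^ 2 / τ ^ 2) 1 ≤ Real.exp (2 * fSmooth τ t / τ ^ 2) := by
  have h0 := fSmooth_nonneg hτ.le ht
  refine max_le ?_ (Real.one_le_exp (by positivity))
  rcases le_or_gt t τ with h | h
  · refine le_trans ?_ (Real.one_le_exp (by positivity))
    rw [div_le_one (by positivity)]
    gcongr
  · have ht' : 0 < t := hτ.trans h
    rw [← Real.log_le_iff_le_exp (by positivity), fSmooth_of_lt hτ h, ← div_pow, Real.log_pow,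
      le_div_iff₀ (by positivity)]
    push_cast
    nlinarith [sq_nonneg τ]

/-- The formula in terms of `wt` has no case distinction, so nothing special happens when `τ₀ = t`.
-/
theorem tendsto_fSmooth {ι : Type*} {l : Filter ι} {τ : ι → ℝ} {τ₀ t : ℝ} (hτ₀ : 0 < τ₀)
    (ht : 0 ≤ t) (hτ : Tendsto τ l (𝓝 τ₀)) :
    Tendsto (fun k => fSmooth (τ k) t) l (𝓝 (fSmooth τ₀ t)) := by
  have hw : Tendsto (fun k => wt (τ k) t) l (𝓝 (wt τ₀ t)) :=
    ((tendsto_const_nhds.div hτ hτ₀.ne').max tendsto_const_nhds).inv₀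
      (lt_of_lt_of_le one_pos (le_max_right _ _)).ne'
  rw [fSmooth_eq_wt hτ₀ ht]
  refine Tendsto.congr' ((hτ.eventually (eventually_gt_nhds hτ₀)).mono fun k hk =>
    (fSmooth_eq_wt hk ht).symm) ?_
  exact (((hw.pow 2).const_mul _).mul_const _).sub
    ((hτ.pow 2).mul (hw.log (wt_pos τ₀ t).ne'))

/-! ### The Frobenius inner product -/

theorem frobInner_eq_trace {n₁ n₂ : ℕ} (A B : Matrix (Fin n₁) (Fin n₂) ℝ) :
    frobInner A B = (Aᵀ * B).trace := by
  simp only [frobInner, Matrix.trace, Matrix.diag, Matrix.mul_apply, Matrix.transpose_apply]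
  exact Finset.sum_comm

theorem frobInner_comm {n₁ n₂ : ℕ} (A B : Matrix (Fin n₁) (Fin n₂) ℝ) :
    frobInner A B = frobInner B A := by
  simp only [frobInner, mul_comm]

theorem frobInner_add_right {n₁ n₂ : ℕ} (A B C : Matrix (Fin n₁) (Fin n₂) ℝ) :
    frobInner A (B + C) = frobInner A B + frobInner A C := by
  simp only [frobInner, Matrix.add_apply, mul_add, Finset.sum_add_distrib]

theorem frobInner_smul_right {n₁ n₂ : ℕ} (c : ℝ) (A B : Matrix (Fin n₁) (Fin n₂) ℝ) :
    frobInner A (c • B) = c * frobInner A B := by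
  simp only [frobInner, Matrix.smul_apply, smul_eq_mul, Finset.mul_sum, mul_left_comm]

theorem frobInner_sub_right {n₁ n₂ : ℕ} (A B C : Matrix (Fin n₁) (Fin n₂) ℝ) :
    frobInner A (B - C) = frobInner A B - frobInner A C := by
  simp only [frobInner, Matrix.sub_apply, mul_sub, Finset.sum_sub_distrib]

theorem frobInner_add_left {n₁ n₂ : ℕ} (A B C : Matrix (Fin n₁) (Fin n₂) ℝ) :
    frobInner (A + B) C = frobInner A C + frobInner B C := by
  rw [frobInner_comm, frobInner_add_right, frobInner_comm C, frobInner_comm C]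

theorem frobInner_smul_left {n₁ n₂ : ℕ} (c : ℝ) (A B : Matrix (Fin n₁) (Fin n₂) ℝ) :
    frobInner (c • A) B = c * frobInner A B := by
  rw [frobInner_comm, frobInner_smul_right, frobInner_comm]

theorem frobInner_sub_left {n₁ n₂ : ℕ} (A B C : Matrix (Fin n₁) (Fin n₂) ℝ) :
    frobInner (A - B) C = frobInner A C - frobInner B C := by
  rw [frobInner_comm, frobInner_sub_right, frobInner_comm C, frobInner_comm C]

theorem frobInner_mul_left {n₁ n₂ n₃ : ℕ} (P : Matrix (Fin n₁) (Fin n₃) ℝ)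
    (A : Matrix (Fin n₁) (Fin n₂) ℝ) (B : Matrix (Fin n₃) (Fin n₂) ℝ) :
    frobInner A (P * B) = frobInner (Pᵀ * A) B := by
  rw [frobInner_eq_trace, frobInner_eq_trace, Matrix.transpose_mul, Matrix.transpose_transpose,
    Matrix.mul_assoc]

theorem frobInner_transpose {n₁ n₂ : ℕ} (A B : Matrix (Fin n₁) (Fin n₂) ℝ) :
    frobInner Aᵀ Bᵀ = frobInner A B := by
  simp only [frobInner, Matrix.transpose_apply]
  exact Finset.sum_comm

theorem frobInner_mul_right {n₁ n₂ n₃ : ℕ} (P : Matrix (Fin n₃) (Fin n₂) ℝ)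
    (A : Matrix (Fin n₁) (Fin n₂) ℝ) (B : Matrix (Fin n₁) (Fin n₃) ℝ) :
    frobInner A (B * P) = frobInner (A * Pᵀ) B := by
  rw [← frobInner_transpose, Matrix.transpose_mul, frobInner_mul_left, ← frobInner_transpose]
  simp

theorem frobInner_self_nonneg {n₁ n₂ : ℕ} (A : Matrix (Fin n₁) (Fin n₂) ℝ) :
    0 ≤ frobInner A A :=
  Finset.sum_nonneg fun _ _ => Finset.sum_nonneg fun _ _ => mul_self_nonneg _

theorem frobInner_self {n₁ n₂ : ℕ} (A : Matrix (Fin n₁) (Fin n₂) ℝ) :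
    frobInner A A = ‖A‖ ^ 2 := by
  rw [Matrix.frobenius_norm_def, ← Real.sqrt_eq_rpow, Real.sq_sqrt (by positivity)]
  simp [frobInner, sq]

theorem transpose_mul_of_mem {n : ℕ} {P : Matrix (Fin n) (Fin n) ℝ}
    (hP : P ∈ Matrix.orthogonalGroup (Fin n) ℝ) : Pᵀ * P = 1 :=
  (Matrix.mem_orthogonalGroup_iff' (Fin n) ℝ).1 hP

theorem mul_transpose_of_mem {n : ℕ} {P : Matrix (Fin n) (Fin n) ℝ}
    (hP : P ∈ Matrix.orthogonalGroup (Fin n) ℝ) : P * Pᵀ = 1 :=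
  (Matrix.mem_orthogonalGroup_iff (Fin n) ℝ).1 hP

theorem transpose_mem {n : ℕ} {P : Matrix (Fin n) (Fin n) ℝ}
    (hP : P ∈ Matrix.orthogonalGroup (Fin n) ℝ) : Pᵀ ∈ Matrix.orthogonalGroup (Fin n) ℝ := by
  rw [Matrix.mem_orthogonalGroup_iff, Matrix.transpose_transpose]
  exact transpose_mul_of_mem hP

theorem abs_det_of_mem {n : ℕ} {P : Matrix (Fin n) (Fin n) ℝ}
    (hP : P ∈ Matrix.orthogonalGroup (Fin n) ℝ) : |P.det| = 1 := by
  have h := congrArg Matrix.det (mul_transpose_of_mem hP)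
  rw [Matrix.det_mul, Matrix.det_transpose, Matrix.det_one] at h
  rcases mul_self_eq_one_iff.1 h with h | h <;> simp [h]

theorem frobInner_orthogonal_left {n₁ n₂ : ℕ} {P : Matrix (Fin n₁) (Fin n₁) ℝ}
    (hP : P ∈ Matrix.orthogonalGroup (Fin n₁) ℝ) (A B : Matrix (Fin n₁) (Fin n₂) ℝ) :
    frobInner (P * A) (P * B) = frobInner A B := by
  rw [frobInner_mul_left, ← Matrix.mul_assoc, transpose_mul_of_mem hP, Matrix.one_mul]

theorem frobInner_orthogonal_right {n₁ n₂ : ℕ} {P : Matrix (Fin n₂) (Fin n₂) ℝ}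
    (hP : P ∈ Matrix.orthogonalGroup (Fin n₂) ℝ) (A B : Matrix (Fin n₁) (Fin n₂) ℝ) :
    frobInner (A * P) (B * P) = frobInner A B := by
  rw [frobInner_mul_right, Matrix.mul_assoc, mul_transpose_of_mem hP, Matrix.mul_one]

/-! ### Hadamard's inequality -/

/-- The determinant is, up to sign, the volume form of Euclidean space evaluated at the columns. -/
theorem abs_det_le_prod_norm_col {n : ℕ} (M : Matrix (Fin n) (Fin n) ℝ) :
    |M.det| ≤ ∏ j, ‖WithLp.toLp 2 (M.col j)‖ := by
  have : Fact (Module.finrank ℝ (EuclideanSpace ℝ (Fin n)) = n) := ⟨by simp⟩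
  let b := EuclideanSpace.basisFun (Fin n) ℝ
  have h := b.toBasis.orientation.abs_volumeForm_apply_le fun j => WithLp.toLp 2 (M.col j)
  rw [b.toBasis.orientation.volumeForm_robust' b, Module.Basis.det_apply] at h
  have hM : (b.toBasis.toMatrix fun j => WithLp.toLp 2 (M.col j)) = M := by
    ext i j
    simp [b, Module.Basis.toMatrix_apply]
  rwa [hM] at h

/-! ### Singular value decomposition -/

/-- The rectangular diagonal matrix with diagonal `s`. -/
def rectDiag (n₁ n₂ : ℕ) (s : ℕ → ℝ) : Matrix (Fin n₁) (Fin n₂) ℝ :=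
  Matrix.of fun i j => if (i : ℕ) = j then s i else 0

/-- `Y = U * diag s * Vᵀ` is a singular value decomposition. -/
structure IsSVD {n₁ n₂ : ℕ} (Y : Matrix (Fin n₁) (Fin n₂) ℝ) (U : Matrix (Fin n₁) (Fin n₁) ℝ)
    (V : Matrix (Fin n₂) (Fin n₂) ℝ) (s : ℕ → ℝ) : Prop where
  left_orthogonal : U ∈ Matrix.orthogonalGroup (Fin n₁) ℝ
  right_orthogonal : V ∈ Matrix.orthogonalGroup (Fin n₂) ℝ
  eq : Y = U * rectDiag n₁ n₂ s * Vᵀ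
  nonneg : ∀ i, 0 ≤ s i
  left_zero : ∀ i, n₁ ≤ i → s i = 0
  right_zero : ∀ i, n₂ ≤ i → s i = 0

theorem sing_nonneg {n₁ n₂ : ℕ} (X : Matrix (Fin n₁) (Fin n₂) ℝ) (i : ℕ) : 0 ≤ sing X i :=
  LinearMap.singularValues_nonneg _ _

theorem sing_of_right_le {n₁ n₂ : ℕ} (X : Matrix (Fin n₁) (Fin n₂) ℝ) {i : ℕ} (hi : n₂ ≤ i) :
    sing X i = 0 :=
  LinearMap.singularValues_of_finrank_le _ (by simpa using hi)

theorem sing_of_left_le {n₁ n₂ : ℕ} (X : Matrix (Fin n₁) (Fin n₂) ℝ) {i : ℕ} (hi : n₁ ≤ i) :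
    sing X i = 0 := by
  rw [sing, LinearMap.singularValues_eq_zero_iff_le_finrank_range]
  refine le_trans ?_ hi
  simpa using Submodule.finrank_le (Matrix.toEuclideanLin X).range

/-- The matrix whose columns are the vectors of an orthonormal basis. -/
noncomputable def basisMatrix {n : ℕ} (b : OrthonormalBasis (Fin n) ℝ (EuclideanSpace ℝ (Fin n))) :
    Matrix (Fin n) (Fin n) ℝ :=
  Matrix.of fun i j => b j i

theorem basisMatrix_mem {n : ℕ} (b : OrthonormalBasis (Fin n) ℝ (EuclideanSpace ℝ (Fin n))) :
    basisMatrix b ∈ Matrix.orthogonalGroup (Fin n) ℝ := by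
  rw [Matrix.mem_orthogonalGroup_iff']
  ext i j
  have h := orthonormal_iff_ite.1 b.orthonormal i j
  rw [PiLp.inner_apply] at h
  simpa [Matrix.mul_apply, basisMatrix, Matrix.one_apply, mul_comm] using h

/-- An orthonormal eigenbasis of `T* T` serves as right singular vectors. The images of those with
nonzero singular value are orthogonal; normalised, they extend to an orthonormal basis of left
singular vectors. -/
theorem exists_isSVD {n₁ n₂ : ℕ} (X : Matrix (Fin n₁) (Fin n₂) ℝ) :
    ∃ U V, IsSVD X U V (sing X) := by
  set T := Matrix.toEuclideanLin X with hT
  have hn : Module.finrank ℝ (EuclideanSpace ℝ (Fin n₂)) = n₂ := by simp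
  let b := T.isSymmetric_adjoint_comp_self.eigenvectorBasis hn
  have hinner : ∀ i j, inner ℝ (T (b i)) (T (b j)) = if i = j then sing X i ^ 2 else 0 := by
    intro i j
    rw [← LinearMap.adjoint_inner_right]
    have h1 := T.isSymmetric_adjoint_comp_self.apply_eigenvectorBasis hn j
    rw [LinearMap.comp_apply] at h1
    simp only [b]
    rw [h1, inner_smul_right, orthonormal_iff_ite.1 (OrthonormalBasis.orthonormal _) i j,
      ← T.sq_singularValues_fin hn]
    split_ifs with h
    · subst h; simp [sing, hT]
    · simp
  -- Only the values on `S` matter; elsewhere the default `0` is replaced by the basis extension.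
  let v : Fin n₁ → EuclideanSpace ℝ (Fin n₁) := fun i =>
    if h : (i : ℕ) < n₂ then (sing X i)⁻¹ • T (b ⟨i, h⟩) else 0
  let S : Set (Fin n₁) := {i | sing X i ≠ 0}
  have hS : ∀ i ∈ S, (i : ℕ) < n₂ := fun i hi => by
    by_contra h
    exact hi (sing_of_right_le X (not_lt.1 h))
  have hv : Orthonormal ℝ (S.domRestrict v) := by
    rw [orthonormal_iff_ite]
    rintro ⟨i, hi⟩ ⟨j, hj⟩
    have hi' : sing X i ≠ 0 := hi
    simp only [Set.domRestrict_apply, v, dif_pos (hS i hi), dif_pos (hS j hj), inner_smul_left,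
      inner_smul_right, hinner, Subtype.mk.injEq, Fin.mk.injEq, Fin.val_inj]
    split_ifs with h
    · subst h
      simp only [map_inv₀, conj_trivial]
      field_simp
    · simp
  obtain ⟨a, ha⟩ := hv.exists_orthonormalBasis_extension_of_card_eq (by simp)
  have hTb : ∀ j : Fin n₂, T (b j) = if h : (j : ℕ) < n₁ then sing X j • a ⟨j, h⟩ else 0 := by
    intro j
    by_cases h0 : sing X j = 0
    · have : T (b j) = 0 := by
        rw [← inner_self_eq_zero (𝕜 := ℝ), hinner, if_pos rfl, h0]; simp
      simp [this, h0]
    · have hj : (j : ℕ) < n₁ := by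
        by_contra h
        exact h0 (sing_of_left_le X (not_lt.1 h))
      rw [dif_pos hj, ha ⟨j, hj⟩ h0]
      simp only [v, dif_pos j.2]
      rw [smul_smul, mul_inv_cancel₀ h0, one_smul]
  refine ⟨basisMatrix a, basisMatrix b, basisMatrix_mem a, basisMatrix_mem b, ?_, sing_nonneg X,
    fun i => sing_of_left_le X, fun i => sing_of_right_le X⟩
  have hXV : X * basisMatrix b = basisMatrix a * rectDiag n₁ n₂ (sing X) := by
    ext i j
    have h1 : (X * basisMatrix b) i j = T (b j) i := by
      simp [hT, Matrix.mul_apply, basisMatrix, Matrix.toLpLin_apply, Matrix.mulVec,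
        dotProduct]
    rw [h1, hTb, Matrix.mul_apply]
    split_ifs with h
    · rw [Finset.sum_eq_single ⟨j, h⟩]
      · simp [basisMatrix, rectDiag, mul_comm]
      · intro k _ hk
        have : (k : ℕ) ≠ j := fun e => hk (Fin.ext e)
        simp [rectDiag, this]
      · simp
    · refine (Finset.sum_eq_zero fun k _ => ?_).symm
      have : (k : ℕ) ≠ j := by omega
      simp [rectDiag, this]
  rw [← hXV, Matrix.mul_assoc]
  rw [mul_transpose_of_mem (basisMatrix_mem b), Matrix.mul_one]

/-! ### Rectangular diagonal matrices -/

theorem sum_fin_ite_val_eq {n : ℕ} (i : ℕ) (g : ℕ → ℝ) :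
    ∑ j : Fin n, (if i = (j : ℕ) then g j else 0) = if i < n then g i else 0 := by
  split_ifs with h
  · rw [Finset.sum_eq_single ⟨i, h⟩]
    · simp
    · intro k _ hk
      exact if_neg fun e => hk (Fin.ext e.symm)
    · simp
  · exact Finset.sum_eq_zero fun k _ => if_neg (by omega)

theorem sum_fin_eq_sum_range_min_left {n₁ n₂ : ℕ} {g : ℕ → ℝ} (hg : ∀ i, n₂ ≤ i → g i = 0) :
    ∑ i : Fin n₁, g i = ∑ i ∈ Finset.range (min n₁ n₂), g i := by
  rw [← Finset.sum_range]
  refine (Finset.sum_subset (Finset.range_mono (min_le_left _ _)) fun i hi hi' => hg i ?_).symm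
  simp only [Finset.mem_range] at hi hi'
  omega

theorem sum_fin_eq_sum_range_min_right {n₁ n₂ : ℕ} {g : ℕ → ℝ} (hg : ∀ i, n₁ ≤ i → g i = 0) :
    ∑ i : Fin n₂, g i = ∑ i ∈ Finset.range (min n₁ n₂), g i := by
  rw [min_comm, sum_fin_eq_sum_range_min_left hg]

theorem rectDiag_transpose (n₁ n₂ : ℕ) (s : ℕ → ℝ) :
    (rectDiag n₁ n₂ s)ᵀ = rectDiag n₂ n₁ s := by
  ext i j
  simp only [rectDiag, Matrix.transpose_apply, Matrix.of_apply, eq_comm (a := (j : ℕ))]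
  split_ifs with h <;> simp [h]

theorem diagonal_mul_rectDiag {n₁ n₂ : ℕ} (d s : ℕ → ℝ) :
    Matrix.diagonal (fun i : Fin n₁ => d i) * rectDiag n₁ n₂ s
      = rectDiag n₁ n₂ fun i => d i * s i := by
  ext i j
  simp [rectDiag, Matrix.diagonal_mul]

theorem rectDiag_mul_diagonal {n₁ n₂ : ℕ} (d s : ℕ → ℝ) :
    rectDiag n₁ n₂ s * Matrix.diagonal (fun i : Fin n₂ => d i)
      = rectDiag n₁ n₂ fun i => d i * s i := by
  ext i j
  by_cases h : (i : ℕ) = j <;> simp [rectDiag, Matrix.mul_diagonal, h, mul_comm]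

theorem rectDiag_mul_transpose {n₁ n₂ : ℕ} {s : ℕ → ℝ} (hs : ∀ i, n₂ ≤ i → s i = 0) :
    rectDiag n₁ n₂ s * (rectDiag n₁ n₂ s)ᵀ = Matrix.diagonal fun i : Fin n₁ => s i ^ 2 := by
  ext i j
  have h1 : ∀ k : Fin n₂, rectDiag n₁ n₂ s i k * (rectDiag n₁ n₂ s)ᵀ k j
      = if (i : ℕ) = k then (fun k : ℕ => s i * if (j : ℕ) = k then s j else 0) k else 0 := by
    intro k
    by_cases h : (i : ℕ) = k <;> simp [rectDiag, h]
  rw [Matrix.mul_apply, (Finset.sum_congr rfl fun k _ => h1 k).trans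
    (sum_fin_ite_val_eq (i : ℕ) fun k : ℕ => s i * if (j : ℕ) = k then s j else 0),
    Matrix.diagonal_apply]
  by_cases hij : i = j
  · subst hij
    by_cases h : (i : ℕ) < n₂
    · simp [h, sq]
    · simp [h, hs i (not_lt.1 h)]
  · have : (j : ℕ) ≠ i := fun e => hij (Fin.ext e.symm)
    simp [hij, this]

theorem frobInner_diagonal {n : ℕ} (N : Matrix (Fin n) (Fin n) ℝ) (d : Fin n → ℝ) :
    frobInner N (Matrix.diagonal d) = ∑ i, N i i * d i := by
  simp [frobInner, Matrix.diagonal_apply]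

theorem frobInner_mul_rectDiag {n₁ n₂ n₃ : ℕ} (M : Matrix (Fin n₃) (Fin n₁) ℝ) {s : ℕ → ℝ}
    (hs : ∀ i, n₂ ≤ i → s i = 0) :
    frobInner (M * rectDiag n₁ n₂ s) (M * rectDiag n₁ n₂ s)
      = ∑ j : Fin n₁, (Mᵀ * M) j j * s j ^ 2 := by
  rw [frobInner_comm, frobInner_mul_right, frobInner_comm, Matrix.mul_assoc,
    rectDiag_mul_transpose hs, frobInner_mul_left, frobInner_diagonal]

theorem frobInner_rectDiag {n₁ n₂ : ℕ} (c : ℕ → ℝ) {s : ℕ → ℝ} (hs : ∀ i, n₂ ≤ i → s i = 0) :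
    frobInner (rectDiag n₁ n₂ c) (rectDiag n₁ n₂ s) = ∑ i : Fin n₁, c i * s i := by
  refine Finset.sum_congr rfl fun i _ => ?_
  have h1 : ∀ k : Fin n₂, rectDiag n₁ n₂ c i k * rectDiag n₁ n₂ s i k
      = if (i : ℕ) = k then (fun k => c k * s k) k else 0 := by
    intro k
    by_cases h : (i : ℕ) = k <;> simp [rectDiag, h]
  rw [(Finset.sum_congr rfl fun k _ => h1 k).trans
    (sum_fin_ite_val_eq (i : ℕ) fun k => c k * s k)]
  split_ifs with h
  · rfl
  · simp [hs i (not_lt.1 h)]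

namespace IsSVD

variable {n₁ n₂ : ℕ} {Y : Matrix (Fin n₁) (Fin n₂) ℝ} {U : Matrix (Fin n₁) (Fin n₁) ℝ}
  {V : Matrix (Fin n₂) (Fin n₂) ℝ} {s : ℕ → ℝ}

theorem transpose (h : IsSVD Y U V s) : IsSVD Yᵀ V U s where
  left_orthogonal := h.right_orthogonal
  right_orthogonal := h.left_orthogonal
  eq := by
    rw [h.eq, Matrix.transpose_mul, Matrix.transpose_mul, rectDiag_transpose,
      Matrix.transpose_transpose, Matrix.mul_assoc]
  nonneg := h.nonneg
  left_zero := h.right_zero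
  right_zero := h.left_zero

theorem frobInner_mul (h : IsSVD Y U V s) {n₃ : ℕ} (K : Matrix (Fin n₃) (Fin n₁) ℝ) :
    frobInner (K * Y) (K * Y) = ∑ j : Fin n₁, ((K * U)ᵀ * (K * U)) j j * s j ^ 2 := by
  rw [← frobInner_mul_rectDiag _ h.right_zero,
    ← frobInner_orthogonal_right (transpose_mem h.right_orthogonal) (K * U * _), h.eq]
  simp only [Matrix.mul_assoc]

theorem frobInner_self (h : IsSVD Y U V s) : frobInner Y Y = ∑ j : Fin n₁, s j ^ 2 := by
  have := h.frobInner_mul (1 : Matrix (Fin n₁) (Fin n₁) ℝ)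
  simpa [transpose_mul_of_mem h.left_orthogonal] using this

end IsSVD

/-! ### The majorization of the low-rank objective -/

/-- `K` does not increase the Euclidean norm. -/
def IsContraction {n : ℕ} (K : Matrix (Fin n) (Fin n) ℝ) : Prop :=
  ∀ x, (K *ᵥ x) ⬝ᵥ (K *ᵥ x) ≤ x ⬝ᵥ x

theorem IsContraction.mul {n : ℕ} {K L : Matrix (Fin n) (Fin n) ℝ} (hK : IsContraction K)
    (hL : IsContraction L) : IsContraction (K * L) := fun x => by
  rw [← Matrix.mulVec_mulVec]
  exact (hK _).trans (hL _)

theorem isContraction_of_mem {n : ℕ} {P : Matrix (Fin n) (Fin n) ℝ}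
    (hP : P ∈ Matrix.orthogonalGroup (Fin n) ℝ) : IsContraction P := fun x => by
  rw [Matrix.dotProduct_mulVec, Matrix.vecMul_mulVec, transpose_mul_of_mem hP, Matrix.vecMul_one]

theorem isContraction_diagonal {n : ℕ} {d : Fin n → ℝ} (h0 : ∀ i, 0 ≤ d i) (h1 : ∀ i, d i ≤ 1) :
    IsContraction (Matrix.diagonal d) := fun x => by
  refine Finset.sum_le_sum fun i _ => ?_
  rw [Matrix.mulVec_diagonal]
  have : d i * d i ≤ 1 := mul_le_one₀ (h1 i) (h0 i) (h1 i)
  nlinarith [mul_nonneg (sub_nonneg.2 this) (mul_self_nonneg (x i))]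

theorem dotProduct_col {n : ℕ} (M : Matrix (Fin n) (Fin n) ℝ) (j : Fin n) :
    M.col j ⬝ᵥ M.col j = (Mᵀ * M) j j := rfl

/-- Take `μ j` to be the squared length of the `j`-th column of `K * U`. It is at most `1` since `K`
is a contraction, and Hadamard's inequality bounds the product of all `μ j` below by `det K ^ 2`.
Then `fSmooth_le` is summed over `j`. -/
theorem IsSVD.sum_fSmooth_le {n₁ n₂ : ℕ} {Y : Matrix (Fin n₁) (Fin n₂) ℝ}
    {U : Matrix (Fin n₁) (Fin n₁) ℝ} {V : Matrix (Fin n₂) (Fin n₂) ℝ} {s : ℕ → ℝ} {τ : ℝ}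
    (hτ : 0 < τ) (h : IsSVD Y U V s) {K : Matrix (Fin n₁) (Fin n₁) ℝ} (hK : IsContraction K)
    (hdet : K.det ≠ 0) :
    ∑ j : Fin n₁, fSmooth τ (s j)
      ≤ 1 / 2 * frobInner (K * Y) (K * Y) - τ ^ 2 * Real.log |K.det| := by
  set μ : Fin n₁ → ℝ := fun j => ((K * U)ᵀ * (K * U)) j j with hμ
  have hμn : ∀ j, ‖WithLp.toLp 2 ((K * U).col j)‖ ^ 2 = μ j := fun j => by
    rw [EuclideanSpace.real_norm_sq_eq]
    exact Finset.sum_congr rfl fun i _ => sq ((K * U) i j)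
  have hμ0 : ∀ j, 0 ≤ μ j := fun j => by
    rw [← hμn]
    positivity
  have hμ1 : ∀ j, μ j ≤ 1 := fun j => by
    have h1 := hK (U.col j)
    rw [dotProduct_col, transpose_mul_of_mem h.left_orthogonal, Matrix.one_apply_eq] at h1
    exact h1
  have hdetU : |(K * U).det| = |K.det| := by
    rw [Matrix.det_mul, abs_mul, abs_det_of_mem h.left_orthogonal, mul_one]
  have hprod : K.det ^ 2 ≤ ∏ j, μ j := by
    have h1 := pow_le_pow_left₀ (abs_nonneg _) (abs_det_le_prod_norm_col (K * U)) 2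
    rw [hdetU, sq_abs, ← Finset.prod_pow] at h1
    simpa only [hμn] using h1
  have hμpos : ∀ j, 0 < μ j := fun j => by
    refine lt_of_le_of_ne (hμ0 j) fun h0 => ?_
    rw [Finset.prod_eq_zero (Finset.mem_univ j) h0.symm] at hprod
    exact hdet (pow_eq_zero_iff two_ne_zero |>.1 (le_antisymm hprod (sq_nonneg _)))
  have hlog : 2 * Real.log |K.det| ≤ ∑ j, Real.log (μ j) := by
    rw [← Real.log_prod fun j _ => (hμpos j).ne']
    have h1 := Real.log_le_log (by positivity) hprod
    rw [← sq_abs, Real.log_pow] at h1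
    exact_mod_cast h1
  rw [h.frobInner_mul]
  calc ∑ j : Fin n₁, fSmooth τ (s j)
      ≤ ∑ j : Fin n₁, (1 / 2 * μ j * s j ^ 2 - 1 / 2 * τ ^ 2 * Real.log (μ j)) :=
        Finset.sum_le_sum fun j _ => fSmooth_le hτ (h.nonneg j) (hμpos j) (hμ1 j)
    _ = 1 / 2 * ∑ j : Fin n₁, μ j * s j ^ 2 - 1 / 2 * τ ^ 2 * ∑ j, Real.log (μ j) := by
        simp only [Finset.sum_sub_distrib, Finset.mul_sum, mul_assoc]
    _ ≤ _ := by nlinarith [mul_le_mul_of_nonneg_left hlog (sq_nonneg τ)]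

theorem Flr_eq_sum_left {n₁ n₂ : ℕ} (τ : ℝ) (Z : Matrix (Fin n₁) (Fin n₂) ℝ) :
    Flr τ Z = ∑ i : Fin n₁, fSmooth τ (sing Z i) :=
  (sum_fin_eq_sum_range_min_left (g := fun i => fSmooth τ (sing Z i)) fun i hi => by
    simp [sing_of_right_le Z hi]).symm

theorem Flr_eq_sum_right {n₁ n₂ : ℕ} (τ : ℝ) (Z : Matrix (Fin n₁) (Fin n₂) ℝ) :
    Flr τ Z = ∑ i : Fin n₂, fSmooth τ (sing Z i) :=
  (sum_fin_eq_sum_range_min_right (g := fun i => fSmooth τ (sing Z i)) fun i hi => by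
    simp [sing_of_left_le Z hi]).symm

/-- The one-sided bound is used twice: for `K` acting on `Y = Z * Lᵀ`, and for a contraction acting
on `Zᵀ` that compares the objective at `Z` with the objective at `Y`. -/
theorem Flr_le {n₁ n₂ : ℕ} {τ : ℝ} (hτ : 0 < τ) (Z : Matrix (Fin n₁) (Fin n₂) ℝ)
    {K : Matrix (Fin n₁) (Fin n₁) ℝ} {L : Matrix (Fin n₂) (Fin n₂) ℝ}
    (hK : IsContraction K) (hL : IsContraction L) (hKdet : K.det ≠ 0) (hLdet : L.det ≠ 0) :
    Flr τ Z ≤ 1 / 2 * frobInner (K * Z * Lᵀ) (K * Z * Lᵀ) - τ ^ 2 * Real.log |K.det|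
      - τ ^ 2 * Real.log |L.det| := by
  obtain ⟨A, B, hY⟩ := exists_isSVD (Z * Lᵀ)
  obtain ⟨A', B', hZ⟩ := exists_isSVD Z
  set s := sing (Z * Lᵀ)
  have h1 := hY.sum_fSmooth_le hτ hK hKdet
  -- With the optimal weights of `Y` in its right singular basis, the bound for `D * Bᵀ * L` on `Zᵀ`
  -- evaluates exactly to the objective at `Y` minus `τ ^ 2 * log |det L|`.
  set D : Matrix (Fin n₂) (Fin n₂) ℝ := Matrix.diagonal fun j : Fin n₂ => wt τ (s j) with hD
  have hDdet : (D * Bᵀ).det ≠ 0 := by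
    rw [← abs_pos, Matrix.det_mul, abs_mul, abs_det_of_mem (transpose_mem hY.right_orthogonal),
      mul_one, hD, Matrix.det_diagonal, abs_pos]
    exact Finset.prod_ne_zero_iff.2 fun j _ => (wt_pos _ _).ne'
  have hDlog : Real.log |(D * Bᵀ).det| = ∑ j : Fin n₂, Real.log (wt τ (s j)) := by
    rw [Matrix.det_mul, abs_mul, abs_det_of_mem (transpose_mem hY.right_orthogonal), mul_one, hD,
      Matrix.det_diagonal, Real.log_abs, Real.log_prod fun j _ => (wt_pos _ _).ne']
  have hDc : IsContraction (D * Bᵀ) :=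
    (isContraction_diagonal (fun _ => (wt_pos _ _).le) fun _ => wt_le_one _ _).mul
      (isContraction_of_mem (transpose_mem hY.right_orthogonal))
  have h2 := hZ.transpose.sum_fSmooth_le hτ (hDc.mul hL)
    (by rw [Matrix.det_mul]; exact mul_ne_zero hDdet hLdet)
  rw [Matrix.det_mul, abs_mul, Real.log_mul (abs_ne_zero.2 hDdet) (abs_ne_zero.2 hLdet), hDlog,
    ← Flr_eq_sum_right] at h2
  have h3 : D * Bᵀ * L * Zᵀ = D * Bᵀ * (Z * Lᵀ)ᵀ := by
    rw [Matrix.transpose_mul, Matrix.transpose_transpose, Matrix.mul_assoc]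
  rw [h3, hY.transpose.frobInner_mul, Matrix.mul_assoc D,
    transpose_mul_of_mem hY.right_orthogonal, Matrix.mul_one, hD] at h2
  have h4 : ∑ j : Fin n₂, fSmooth τ (s j) = ∑ i : Fin n₁, fSmooth τ (s i) :=
    (Flr_eq_sum_right τ (Z * Lᵀ)).symm.trans (Flr_eq_sum_left τ (Z * Lᵀ))
  have h5 : ∑ j : Fin n₂, fSmooth τ (s j) = 1 / 2 * ∑ j : Fin n₂, wt τ (s j) ^ 2 * s j ^ 2
      - τ ^ 2 * ∑ j : Fin n₂, Real.log (wt τ (s j)) := by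
    rw [Finset.sum_congr rfl fun (j : Fin n₂) _ => fSmooth_eq_wt hτ (hY.nonneg j)]
    simp only [Finset.sum_sub_distrib, Finset.mul_sum, mul_assoc]
  simp only [Matrix.diagonal_transpose, Matrix.diagonal_mul_diagonal,
    Matrix.diagonal_apply_eq] at h2
  simp only [sq] at h2 h5
  rw [Matrix.mul_assoc]
  simp only [sq] at h1 ⊢
  linarith

/-! ### Weight operators -/

/-- `T` is a symmetric positive semidefinite linear operator bounded by `C`. -/
structure IsWeight {n₁ n₂ : ℕ} (T : Matrix (Fin n₁) (Fin n₂) ℝ → Matrix (Fin n₁) (Fin n₂) ℝ)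
    (C : ℝ) : Prop where
  map_add : ∀ A B, T (A + B) = T A + T B
  map_smul : ∀ (c : ℝ) A, T (c • A) = c • T A
  symm : ∀ A B, frobInner A (T B) = frobInner (T A) B
  nonneg : ∀ A, 0 ≤ frobInner A (T A)
  le : ∀ A, frobInner A (T A) ≤ C * frobInner A A

theorem IsWeight.add {n₁ n₂ : ℕ} {S T : Matrix (Fin n₁) (Fin n₂) ℝ → Matrix (Fin n₁) (Fin n₂) ℝ}
    {C D : ℝ} (hS : IsWeight S C) (hT : IsWeight T D) :
    IsWeight (fun A => S A + T A) (C + D) where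
  map_add A B := by rw [hS.map_add, hT.map_add]; abel
  map_smul c A := by rw [hS.map_smul, hT.map_smul, smul_add]
  symm A B := by rw [frobInner_add_right, frobInner_add_left, hS.symm, hT.symm]
  nonneg A := by rw [frobInner_add_right]; exact add_nonneg (hS.nonneg A) (hT.nonneg A)
  le A := by
    rw [frobInner_add_right, add_mul]
    exact add_le_add (hS.le A) (hT.le A)

theorem IsContraction.frobInner_le {n₁ n₂ : ℕ} {K : Matrix (Fin n₁) (Fin n₁) ℝ}
    (hK : IsContraction K) (A : Matrix (Fin n₁) (Fin n₂) ℝ) :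
    frobInner (K * A) (K * A) ≤ frobInner A A := by
  rw [← frobInner_transpose, ← frobInner_transpose A]
  exact Finset.sum_le_sum fun j _ => hK (A.col j)

/-- The operator is `S* S` for `S Z = K * Z * Lᵀ`, which does not increase the Frobenius norm. -/
theorem isWeight_of_contractions {n₁ n₂ : ℕ} {K : Matrix (Fin n₁) (Fin n₁) ℝ}
    {L : Matrix (Fin n₂) (Fin n₂) ℝ} (hK : IsContraction K) (hL : IsContraction L) :
    IsWeight (fun Z : Matrix (Fin n₁) (Fin n₂) ℝ => Kᵀ * (K * Z * Lᵀ) * L) 1 := by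
  have key : ∀ A B : Matrix (Fin n₁) (Fin n₂) ℝ,
      frobInner A (Kᵀ * (K * B * Lᵀ) * L) = frobInner (K * A * Lᵀ) (K * B * Lᵀ) := fun A B => by
    rw [frobInner_mul_right, frobInner_mul_left, Matrix.transpose_transpose,
      ← Matrix.mul_assoc K A]
  refine ⟨fun A B => ?_, fun c A => ?_, fun A B => ?_, fun A => ?_, fun A => ?_⟩
  · simp only [Matrix.mul_add, Matrix.add_mul]
  · simp only [Matrix.mul_smul, Matrix.smul_mul]
  · rw [frobInner_comm _ B, key, key, frobInner_comm]
  · rw [key]; exact frobInner_self_nonneg _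
  · rw [key, one_mul, ← frobInner_transpose, Matrix.transpose_mul, Matrix.transpose_transpose]
    refine (hL.frobInner_le _).trans ?_
    rw [frobInner_transpose]
    exact hK.frobInner_le A

/-! ### The low-rank weight operator as a majorizer -/

/-- The contraction `diag (√h) * Pᵀ`, where `h` is the vector of weights of `X`. -/
noncomputable def sqrtWeight {n₁ n₂ n : ℕ} (X : Matrix (Fin n₁) (Fin n₂) ℝ) (ε : ℝ)
    (P : Matrix (Fin n) (Fin n) ℝ) : Matrix (Fin n) (Fin n) ℝ :=
  Matrix.diagonal (fun i : Fin n => √(wt ε (sing X i))) * Pᵀ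

section sqrtWeight

variable {n₁ n₂ n : ℕ} (X : Matrix (Fin n₁) (Fin n₂) ℝ) (ε : ℝ) {P : Matrix (Fin n) (Fin n) ℝ}

theorem sqrtWeight_transpose_mul_self (P : Matrix (Fin n) (Fin n) ℝ) :
    (sqrtWeight X ε P)ᵀ * sqrtWeight X ε P = P * sigmaInv X ε n * Pᵀ := by
  have : Matrix.diagonal (fun i : Fin n => √(wt ε (sing X i)))
      * Matrix.diagonal (fun i : Fin n => √(wt ε (sing X i))) = sigmaInv X ε n := by
    rw [Matrix.diagonal_mul_diagonal, sigmaInv]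
    congr 1
    ext i
    exact Real.mul_self_sqrt (wt_pos _ _).le
  rw [sqrtWeight, Matrix.transpose_mul, Matrix.transpose_transpose, Matrix.diagonal_transpose,
    ← this]
  simp only [Matrix.mul_assoc]

theorem isContraction_sqrtWeight (hP : P ∈ Matrix.orthogonalGroup (Fin n) ℝ) :
    IsContraction (sqrtWeight X ε P) :=
  (isContraction_diagonal (fun _ => Real.sqrt_nonneg _) fun _ =>
    Real.sqrt_le_one.2 (wt_le_one _ _)).mul (isContraction_of_mem (transpose_mem hP))

theorem abs_det_sqrtWeight (hP : P ∈ Matrix.orthogonalGroup (Fin n) ℝ) :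
    |(sqrtWeight X ε P).det| = ∏ i : Fin n, √(wt ε (sing X i)) := by
  rw [sqrtWeight, Matrix.det_mul, abs_mul, abs_det_of_mem (transpose_mem hP), mul_one,
    Matrix.det_diagonal, abs_of_nonneg (Finset.prod_nonneg fun _ _ => Real.sqrt_nonneg _)]

theorem det_sqrtWeight_ne_zero (hP : P ∈ Matrix.orthogonalGroup (Fin n) ℝ) :
    (sqrtWeight X ε P).det ≠ 0 := by
  rw [← abs_ne_zero, abs_det_sqrtWeight X ε hP]
  exact Finset.prod_ne_zero_iff.2 fun i _ => (Real.sqrt_pos.2 (wt_pos _ _)).ne'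

theorem log_abs_det_sqrtWeight (hP : P ∈ Matrix.orthogonalGroup (Fin n) ℝ) :
    Real.log |(sqrtWeight X ε P).det| = 1 / 2 * ∑ i : Fin n, Real.log (wt ε (sing X i)) := by
  rw [abs_det_sqrtWeight X ε hP,
    Real.log_prod fun i _ => (Real.sqrt_pos.2 (wt_pos _ _)).ne', Finset.mul_sum]
  refine Finset.sum_congr rfl fun i _ => ?_
  rw [Real.log_sqrt (wt_pos _ _).le]
  ring

end sqrtWeight

theorem Wlr_eq {n₁ n₂ : ℕ} (X : Matrix (Fin n₁) (Fin n₂) ℝ) (ε : ℝ)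
    (U : Matrix (Fin n₁) (Fin n₁) ℝ) (V : Matrix (Fin n₂) (Fin n₂) ℝ) :
    Wlr X ε U V = fun Z => (sqrtWeight X ε U)ᵀ * (sqrtWeight X ε U * Z * (sqrtWeight X ε V)ᵀ)
      * sqrtWeight X ε V := by
  ext1 Z
  have : (sqrtWeight X ε U)ᵀ * (sqrtWeight X ε U * Z * (sqrtWeight X ε V)ᵀ) * sqrtWeight X ε V
      = ((sqrtWeight X ε U)ᵀ * sqrtWeight X ε U) * Z
        * ((sqrtWeight X ε V)ᵀ * sqrtWeight X ε V) := by
    simp only [Matrix.mul_assoc]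
  rw [this, sqrtWeight_transpose_mul_self, sqrtWeight_transpose_mul_self, Wlr]
  simp only [Matrix.mul_assoc]

theorem IsSingularBases.isWeight {n₁ n₂ : ℕ} {X : Matrix (Fin n₁) (Fin n₂) ℝ} {ε : ℝ}
    {U : Matrix (Fin n₁) (Fin n₁) ℝ} {V : Matrix (Fin n₂) (Fin n₂) ℝ}
    (h : IsSingularBases X ε U V) : IsWeight (Wlr X ε U V) 1 := by
  rw [Wlr_eq]
  exact isWeight_of_contractions (isContraction_sqrtWeight X ε h.left_orthogonal)
    (isContraction_sqrtWeight X ε h.right_orthogonal)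

theorem frobInner_Wlr {n₁ n₂ : ℕ} (X : Matrix (Fin n₁) (Fin n₂) ℝ) (ε : ℝ)
    (U : Matrix (Fin n₁) (Fin n₁) ℝ) (V : Matrix (Fin n₂) (Fin n₂) ℝ)
    (Z : Matrix (Fin n₁) (Fin n₂) ℝ) :
    frobInner Z (Wlr X ε U V Z) = frobInner (sqrtWeight X ε U * Z * (sqrtWeight X ε V)ᵀ)
      (sqrtWeight X ε U * Z * (sqrtWeight X ε V)ᵀ) := by
  rw [Wlr_eq, frobInner_mul_right, frobInner_mul_left, Matrix.transpose_transpose,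
    ← Matrix.mul_assoc (sqrtWeight X ε U) Z]

/-- It suffices that one of the two indices is above the threshold: a left singular vector
determines its whole row of `Uᵀ * X * V`, a right one its whole column. -/
theorem IsSingularBases.transpose_mul_mul_apply {n₁ n₂ : ℕ} {X : Matrix (Fin n₁) (Fin n₂) ℝ}
    {ε : ℝ} {U : Matrix (Fin n₁) (Fin n₁) ℝ} {V : Matrix (Fin n₂) (Fin n₂) ℝ} (hε : 0 < ε)
    (h : IsSingularBases X ε U V) (i : Fin n₁) (j : Fin n₂)
    (hij : ε < sing X i ∨ ε < sing X j) :
    (Uᵀ * X * V) i j = if (i : ℕ) = j then sing X i else 0 := by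
  rcases hij with hi | hj
  · have hi2 : (i : ℕ) < n₂ := by
      by_contra h'
      rw [sing_of_right_le X (not_lt.1 h')] at hi
      exact hε.not_gt hi
    have h1 : (Uᵀ * X * V) i j = (Xᵀ *ᵥ U.col i) ⬝ᵥ V.col j := by
      rw [Matrix.mulVec_transpose]; rfl
    have h2 : V.col ⟨i, hi2⟩ ⬝ᵥ V.col j = (Vᵀ * V) ⟨i, hi2⟩ j := rfl
    rw [h1, h.mul_left i ⟨i, hi2⟩ rfl hi, smul_dotProduct, h2,
      transpose_mul_of_mem h.right_orthogonal, Matrix.one_apply]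
    simp [Fin.ext_iff]
  · have hj1 : (j : ℕ) < n₁ := by
      by_contra h'
      rw [sing_of_left_le X (not_lt.1 h')] at hj
      exact hε.not_gt hj
    have h1 : (Uᵀ * X * V) i j = U.col i ⬝ᵥ (X *ᵥ V.col j) := by
      rw [Matrix.mul_assoc]; rfl
    have h2 : U.col i ⬝ᵥ U.col ⟨j, hj1⟩ = (Uᵀ * U) i ⟨j, hj1⟩ := rfl
    rw [h1, h.mul_right ⟨j, hj1⟩ j rfl hj, dotProduct_smul, h2,
      transpose_mul_of_mem h.left_orthogonal, Matrix.one_apply]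
    by_cases e : (i : ℕ) = j <;> simp [Fin.ext_iff, e]

/-- The block of `Uᵀ * X * V` with both indices at or below the threshold is unknown, but its
weights are `1`. Weighting therefore changes only diagonal entries, and the unweighted total is the
sum of squared singular values by orthogonal invariance. -/
theorem IsSingularBases.frobInner_Wlr_self {n₁ n₂ : ℕ} {X : Matrix (Fin n₁) (Fin n₂) ℝ}
    {ε : ℝ} {U : Matrix (Fin n₁) (Fin n₁) ℝ} {V : Matrix (Fin n₂) (Fin n₂) ℝ} (hε : 0 < ε)
    (h : IsSingularBases X ε U V) :
    frobInner X (Wlr X ε U V X) = ∑ i : Fin n₁, wt ε (sing X i) ^ 2 * sing X i ^ 2 := by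
  obtain ⟨A, B, hX⟩ := exists_isSVD X
  have hentry : ∀ i j, (sqrtWeight X ε U * X * (sqrtWeight X ε V)ᵀ) i j
      = √(wt ε (sing X i)) * (Uᵀ * X * V) i j * √(wt ε (sing X j)) := fun i j => by
    rw [sqrtWeight, sqrtWeight, Matrix.transpose_mul, Matrix.transpose_transpose,
      Matrix.diagonal_transpose, ← Matrix.mul_assoc, Matrix.mul_diagonal, Matrix.mul_assoc,
      Matrix.mul_assoc, Matrix.diagonal_mul, Matrix.mul_assoc]
  have hpt : ∀ i j, (sqrtWeight X ε U * X * (sqrtWeight X ε V)ᵀ) i j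
      * (sqrtWeight X ε U * X * (sqrtWeight X ε V)ᵀ) i j
      = (Uᵀ * X * V) i j * (Uᵀ * X * V) i j
        + if (i : ℕ) = j then (fun j => (wt ε (sing X j) ^ 2 - 1) * sing X j ^ 2) j else 0 := by
    intro i j
    have h1 : (sqrtWeight X ε U * X * (sqrtWeight X ε V)ᵀ) i j
        * (sqrtWeight X ε U * X * (sqrtWeight X ε V)ᵀ) i j
        = wt ε (sing X i) * wt ε (sing X j) * ((Uᵀ * X * V) i j * (Uᵀ * X * V) i j) := by
      rw [hentry]
      linear_combination ((Uᵀ * X * V) i j * (Uᵀ * X * V) i j) *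
        (√(wt ε (sing X j)) * √(wt ε (sing X j)) * Real.mul_self_sqrt (wt_pos ε (sing X i)).le
        + wt ε (sing X i) * Real.mul_self_sqrt (wt_pos ε (sing X j)).le)
    rw [h1]
    by_cases hij : ε < sing X i ∨ ε < sing X j
    · rw [h.transpose_mul_mul_apply hε i j hij]
      split_ifs with e
      · rw [e]; ring
      · ring
    · push Not at hij
      simp [wt_of_le hε hij.1, wt_of_le hε hij.2]
  have hsum : ∀ i : Fin n₁, ∑ j : Fin n₂, (if (i : ℕ) = j then
      (fun j => (wt ε (sing X j) ^ 2 - 1) * sing X j ^ 2) j else 0)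
      = (wt ε (sing X i) ^ 2 - 1) * sing X i ^ 2 := fun i => by
    refine (sum_fin_ite_val_eq (i : ℕ)
      fun j => (wt ε (sing X j) ^ 2 - 1) * sing X j ^ 2).trans ?_
    split_ifs with hi
    · rfl
    · simp [sing_of_right_le X (not_lt.1 hi)]
  have hnorm : frobInner (Uᵀ * X * V) (Uᵀ * X * V) = ∑ i : Fin n₁, sing X i ^ 2 := by
    rw [frobInner_orthogonal_right h.right_orthogonal,
      frobInner_orthogonal_left (transpose_mem h.left_orthogonal), hX.frobInner_self]
  rw [frobInner_Wlr, frobInner]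
  simp only [hpt, Finset.sum_add_distrib]
  rw [Finset.sum_congr rfl fun i _ => hsum i]
  change frobInner (Uᵀ * X * V) (Uᵀ * X * V) + _ = _
  rw [hnorm, ← Finset.sum_add_distrib]
  exact Finset.sum_congr rfl fun i _ => by ring

/-- This is `IRLS.Flr_le` with the square-root weights, for which the right-hand side at `Z = X`
equals `Flr ε X`. -/
theorem IsSingularBases.Flr_le {n₁ n₂ : ℕ} {X : Matrix (Fin n₁) (Fin n₂) ℝ}
    {ε : ℝ} {U : Matrix (Fin n₁) (Fin n₁) ℝ} {V : Matrix (Fin n₂) (Fin n₂) ℝ} (hε : 0 < ε)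
    (h : IsSingularBases X ε U V) (Z : Matrix (Fin n₁) (Fin n₂) ℝ) :
    Flr ε Z ≤ Flr ε X + 1 / 2 * frobInner Z (Wlr X ε U V Z)
      - 1 / 2 * frobInner X (Wlr X ε U V X) := by
  have h1 := IRLS.Flr_le hε Z (isContraction_sqrtWeight X ε h.left_orthogonal)
    (isContraction_sqrtWeight X ε h.right_orthogonal)
    (det_sqrtWeight_ne_zero X ε h.left_orthogonal)
    (det_sqrtWeight_ne_zero X ε h.right_orthogonal)
  rw [← frobInner_Wlr, log_abs_det_sqrtWeight X ε h.left_orthogonal,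
    log_abs_det_sqrtWeight X ε h.right_orthogonal] at h1
  -- Indices beyond the smaller dimension have weight `1` and contribute no logarithm, so both
  -- determinants give the same sum.
  have h2 : ∑ i : Fin n₂, Real.log (wt ε (sing X i)) = ∑ i : Fin n₁, Real.log (wt ε (sing X i)) :=
    (sum_fin_eq_sum_range_min_right (g := fun i => Real.log (wt ε (sing X i))) fun i hi => by
      simp [sing_of_left_le X hi, wt]).trans
    (sum_fin_eq_sum_range_min_left (g := fun i => Real.log (wt ε (sing X i))) fun i hi => by
      simp [sing_of_right_le X hi, wt]).symm
  have h3 : Flr ε X = 1 / 2 * ∑ i : Fin n₁, wt ε (sing X i) ^ 2 * sing X i ^ 2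
      - ε ^ 2 * ∑ i : Fin n₁, Real.log (wt ε (sing X i)) := by
    rw [Flr_eq_sum_left,
      Finset.sum_congr rfl fun (i : Fin n₁) _ => fSmooth_eq_wt hε (sing_nonneg X i)]
    simp only [Finset.sum_sub_distrib, Finset.mul_sum, mul_assoc]
  rw [h.frobInner_Wlr_self hε]
  rw [h2] at h1
  linarith

/-! ### The lower bound for the low-rank objective -/

theorem sum_rectDiag_row {n₁ n₂ : ℕ} {s : ℕ → ℝ} (hs : ∀ i, n₂ ≤ i → s i = 0) (i : Fin n₁) :
    ∑ j, rectDiag n₁ n₂ s i j = s i := by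
  have h1 : ∀ j : Fin n₂, rectDiag n₁ n₂ s i j = if (i : ℕ) = j then s j else 0 := fun j => by
    by_cases h : (i : ℕ) = j <;> simp [rectDiag, h]
  rw [(Finset.sum_congr rfl fun j _ => h1 j).trans (sum_fin_ite_val_eq (i : ℕ) s)]
  split_ifs with h
  · rfl
  · exact (hs i (not_lt.1 h)).symm

theorem sum_rectDiag_col {n₁ n₂ : ℕ} {s : ℕ → ℝ} (hs : ∀ i, n₁ ≤ i → s i = 0) (j : Fin n₂) :
    ∑ i, rectDiag n₁ n₂ s i j = s j := by
  rw [← sum_rectDiag_row hs j, ← rectDiag_transpose]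
  rfl

/-- A trace inequality of von Neumann type, from `P i k * Q j l ≤ (P i k ^ 2 + Q j l ^ 2) / 2` and
nonnegativity of both diagonals. Each half then collapses, since rows and columns of a rectangular
diagonal matrix have at most one nonzero entry. -/
theorem frobInner_rectDiag_mul_le {n₁ n₂ : ℕ} {c s : ℕ → ℝ} (hc : ∀ i, 0 ≤ c i)
    (hs : ∀ i, 0 ≤ s i) (hc₁ : ∀ i, n₁ ≤ i → c i = 0) (hc₂ : ∀ i, n₂ ≤ i → c i = 0)
    (hs₁ : ∀ i, n₁ ≤ i → s i = 0) (hs₂ : ∀ i, n₂ ≤ i → s i = 0)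
    (P : Matrix (Fin n₁) (Fin n₁) ℝ) (Q : Matrix (Fin n₂) (Fin n₂) ℝ) :
    frobInner (rectDiag n₁ n₂ c) (P * rectDiag n₁ n₂ s * Qᵀ)
      ≤ 1 / 2 * ∑ i : Fin n₁, ∑ k : Fin n₁, P i k ^ 2 * (c i * s k)
        + 1 / 2 * ∑ j : Fin n₂, ∑ l : Fin n₂, Q j l ^ 2 * (c j * s l) := by
  set C := rectDiag n₁ n₂ c with hC
  set S := rectDiag n₁ n₂ s with hS
  have hC0 : ∀ i j, 0 ≤ C i j := fun i j => by
    simp only [hC, rectDiag, Matrix.of_apply]; split_ifs <;> simp [hc]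
  have hS0 : ∀ i j, 0 ≤ S i j := fun i j => by
    simp only [hS, rectDiag, Matrix.of_apply]; split_ifs <;> simp [hs]
  calc frobInner C (P * S * Qᵀ)
      = ∑ i, ∑ j, ∑ l, ∑ k, C i j * S k l * (P i k * Q j l) := by
        simp only [frobInner, Matrix.mul_apply, Matrix.transpose_apply, Finset.mul_sum,
          Finset.sum_mul]
        refine Finset.sum_congr rfl fun i _ => Finset.sum_congr rfl fun j _ =>
          Finset.sum_congr rfl fun l _ => Finset.sum_congr rfl fun k _ => by ring
    _ ≤ ∑ i, ∑ j, ∑ l, ∑ k, C i j * S k l * (1 / 2 * P i k ^ 2 + 1 / 2 * Q j l ^ 2) := by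
        refine Finset.sum_le_sum fun i _ => Finset.sum_le_sum fun j _ =>
          Finset.sum_le_sum fun l _ => Finset.sum_le_sum fun k _ =>
            mul_le_mul_of_nonneg_left ?_ (mul_nonneg (hC0 i j) (hS0 k l))
        nlinarith [sq_nonneg (P i k - Q j l)]
    _ = (∑ i, ∑ j, ∑ l, ∑ k, C i j * S k l * (1 / 2 * P i k ^ 2))
        + ∑ i, ∑ j, ∑ l, ∑ k, C i j * S k l * (1 / 2 * Q j l ^ 2) := by
        simp only [mul_add, Finset.sum_add_distrib]
    _ = _ := by
        congr 1
        · rw [Finset.mul_sum]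
          refine Finset.sum_congr rfl fun i _ => ?_
          calc ∑ j, ∑ l, ∑ k, C i j * S k l * (1 / 2 * P i k ^ 2)
              = ∑ j, C i j * ∑ k, (∑ l, S k l) * (1 / 2 * P i k ^ 2) := by
                refine Finset.sum_congr rfl fun j _ => ?_
                rw [Finset.sum_comm, Finset.mul_sum]
                refine Finset.sum_congr rfl fun k _ => ?_
                rw [Finset.sum_mul, Finset.mul_sum]
                exact Finset.sum_congr rfl fun l _ => by ring
            _ = c i * ∑ k : Fin n₁, s k * (1 / 2 * P i k ^ 2) := by
                rw [← Finset.sum_mul, hC, sum_rectDiag_row hc₂]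
                simp only [hS, sum_rectDiag_row hs₂]
            _ = _ := by
                rw [Finset.mul_sum, Finset.mul_sum]
                exact Finset.sum_congr rfl fun k _ => by ring
        · rw [Finset.sum_comm, Finset.mul_sum]
          refine Finset.sum_congr rfl fun j _ => ?_
          calc ∑ i, ∑ l, ∑ k, C i j * S k l * (1 / 2 * Q j l ^ 2)
              = ∑ i, C i j * ∑ l, (∑ k, S k l) * (1 / 2 * Q j l ^ 2) := by
                refine Finset.sum_congr rfl fun i _ => ?_
                rw [Finset.mul_sum]
                refine Finset.sum_congr rfl fun l _ => ?_
                rw [Finset.sum_mul, Finset.mul_sum]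
                exact Finset.sum_congr rfl fun k _ => by ring
            _ = c j * ∑ l : Fin n₂, s l * (1 / 2 * Q j l ^ 2) := by
                rw [← Finset.sum_mul, hC, sum_rectDiag_col hc₁]
                simp only [hS, sum_rectDiag_col hs₁]
            _ = _ := by
                rw [Finset.mul_sum, Finset.mul_sum]
                exact Finset.sum_congr rfl fun k _ => by ring

theorem sum_sq_row_of_mem {n : ℕ} {P : Matrix (Fin n) (Fin n) ℝ}
    (hP : P ∈ Matrix.orthogonalGroup (Fin n) ℝ) (i : Fin n) : ∑ k, P i k ^ 2 = 1 := by
  have h := congrFun₂ (mul_transpose_of_mem hP) i i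
  simpa [Matrix.mul_apply, sq] using h

theorem sum_sq_col_of_mem {n : ℕ} {P : Matrix (Fin n) (Fin n) ℝ}
    (hP : P ∈ Matrix.orthogonalGroup (Fin n) ℝ) (k : Fin n) : ∑ i, P i k ^ 2 = 1 :=
  sum_sq_row_of_mem (transpose_mem hP) k

/-- Averaging a pointwise bound over the doubly stochastic matrix `P i k ^ 2`. -/
theorem sum_sq_mul_le_of_mem {n : ℕ} {P : Matrix (Fin n) (Fin n) ℝ}
    (hP : P ∈ Matrix.orthogonalGroup (Fin n) ℝ) {a b : Fin n → ℝ} {w : Fin n → Fin n → ℝ}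
    (h : ∀ i k, w i k ≤ a k - b i) :
    ∑ i, ∑ k, P i k ^ 2 * w i k ≤ ∑ k, a k - ∑ i, b i := by
  calc ∑ i, ∑ k, P i k ^ 2 * w i k ≤ ∑ i, ∑ k, P i k ^ 2 * (a k - b i) :=
        Finset.sum_le_sum fun i _ => Finset.sum_le_sum fun k _ =>
          mul_le_mul_of_nonneg_left (h i k) (sq_nonneg _)
    _ = ∑ i, ∑ k, P i k ^ 2 * a k - ∑ i, ∑ k, P i k ^ 2 * b i := by
        simp only [mul_sub, Finset.sum_sub_distrib]
    _ = _ := by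
        rw [Finset.sum_comm]
        simp only [← Finset.sum_mul, sum_sq_row_of_mem hP, sum_sq_col_of_mem hP, one_mul]

/-- After expanding the square, only `⟨G + 2 X, Z⟩` couples `X` and `Z`. The trace inequality
reduces it to products of singular values; `le_fSmooth` bounds each product by a difference of a
term in `Z` and a term in `X`, and such bounds survive doubly stochastic averaging. -/
theorem IsSVD.le_Flr {n₁ n₂ : ℕ} {X : Matrix (Fin n₁) (Fin n₂) ℝ} {τ : ℝ}
    {U : Matrix (Fin n₁) (Fin n₁) ℝ} {V : Matrix (Fin n₂) (Fin n₂) ℝ} (hτ : 0 < τ)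
    (hX : IsSVD X U V (sing X)) (Z : Matrix (Fin n₁) (Fin n₂) ℝ) :
    Flr τ X + frobInner (U * rectDiag n₁ n₂ (fun i => wt τ (sing X i) ^ 2 * sing X i) * Vᵀ) (Z - X)
      - frobInner (Z - X) (Z - X) ≤ Flr τ Z := by
  obtain ⟨A, B, hZ⟩ := exists_isSVD Z
  set G := U * rectDiag n₁ n₂ (fun i => wt τ (sing X i) ^ 2 * sing X i) * Vᵀ with hG
  have horth : ∀ {n : ℕ} {P Q : Matrix (Fin n) (Fin n) ℝ}, P ∈ Matrix.orthogonalGroup (Fin n) ℝ →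
      Q ∈ Matrix.orthogonalGroup (Fin n) ℝ → Pᵀ * Q ∈ Matrix.orthogonalGroup (Fin n) ℝ :=
    fun hP hQ => mul_mem (transpose_mem hP) hQ
  have hP := horth hX.left_orthogonal hZ.left_orthogonal
  have hQ := horth hX.right_orthogonal hZ.right_orthogonal
  -- The first summand comes from `G`, the second from the cross term of the squared norm.
  set c : ℕ → ℝ := fun i => wt τ (sing X i) ^ 2 * sing X i + 2 * sing X i with hc
  have hinner : frobInner (G + (2 : ℝ) • X) Z
      = frobInner (rectDiag n₁ n₂ c) (Uᵀ * A * rectDiag n₁ n₂ (sing Z) * (Vᵀ * B)ᵀ) := by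
    have h1 : G + (2 : ℝ) • X = U * rectDiag n₁ n₂ c * Vᵀ := by
      have : rectDiag n₁ n₂ c = rectDiag n₁ n₂ (fun i => wt τ (sing X i) ^ 2 * sing X i)
          + (2 : ℝ) • rectDiag n₁ n₂ (sing X) := by
        ext i j
        by_cases h : (i : ℕ) = j <;> simp [rectDiag, hc, h]
      rw [this, hG, Matrix.mul_add, Matrix.add_mul, Matrix.mul_smul, Matrix.smul_mul, ← hX.eq]
    rw [h1, ← frobInner_orthogonal_left (transpose_mem hX.left_orthogonal),
      ← frobInner_orthogonal_right hX.right_orthogonal]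
    congr 1
    · rw [← Matrix.mul_assoc, ← Matrix.mul_assoc, transpose_mul_of_mem hX.left_orthogonal,
        Matrix.one_mul, Matrix.mul_assoc, transpose_mul_of_mem hX.right_orthogonal, Matrix.mul_one]
    · conv_lhs => rw [hZ.eq]
      rw [Matrix.transpose_mul, Matrix.transpose_transpose]
      simp only [Matrix.mul_assoc]
  have hle := frobInner_rectDiag_mul_le (c := c) (s := sing Z)
    (fun i => by have := sing_nonneg X i; positivity) (sing_nonneg Z)
    (fun i hi => by simp [hc, sing_of_left_le X hi])
    (fun i hi => by simp [hc, sing_of_right_le X hi])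
    hZ.left_zero hZ.right_zero (Uᵀ * A) (Vᵀ * B)
  rw [← hinner] at hle
  have hpt : ∀ i k : ℕ, c i * sing Z k ≤ (fSmooth τ (sing Z k) + sing Z k ^ 2)
      - (fSmooth τ (sing X i) - wt τ (sing X i) ^ 2 * sing X i ^ 2 - sing X i ^ 2) := fun i k => by
    have := le_fSmooth hτ (sing_nonneg X i) (sing_nonneg Z k)
    simp only [hc]
    nlinarith
  have h1 := sum_sq_mul_le_of_mem hP fun i k : Fin n₁ => hpt i k
  have h2 := sum_sq_mul_le_of_mem hQ fun i k : Fin n₂ => hpt i k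
  simp only [Finset.sum_add_distrib, Finset.sum_sub_distrib, ← Flr_eq_sum_left,
    ← hX.frobInner_self, ← hZ.frobInner_self] at h1
  simp only [Finset.sum_add_distrib, Finset.sum_sub_distrib, ← Flr_eq_sum_right,
    ← hX.transpose.frobInner_self, ← hZ.transpose.frobInner_self, frobInner_transpose] at h2
  have hGX : ∑ i : Fin n₁, wt τ (sing X i) ^ 2 * sing X i ^ 2 = frobInner G X := by
    conv_rhs => rw [hG]; arg 2; rw [hX.eq]
    rw [frobInner_orthogonal_right (transpose_mem hX.right_orthogonal),
      frobInner_orthogonal_left hX.left_orthogonal, frobInner_rectDiag _ hX.right_zero]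
    exact Finset.sum_congr rfl fun i _ => by ring
  have hGX' : ∑ i : Fin n₂, wt τ (sing X i) ^ 2 * sing X i ^ 2
      = ∑ i : Fin n₁, wt τ (sing X i) ^ 2 * sing X i ^ 2 :=
    (sum_fin_eq_sum_range_min_right (g := fun i => wt τ (sing X i) ^ 2 * sing X i ^ 2)
      fun i hi => by simp [sing_of_left_le X hi]).trans
    (sum_fin_eq_sum_range_min_left (g := fun i => wt τ (sing X i) ^ 2 * sing X i ^ 2)
      fun i hi => by simp [sing_of_right_le X hi]).symm
  rw [hGX'] at h2
  rw [hGX] at h1 h2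
  rw [frobInner_add_left, frobInner_smul_left] at hle
  simp only [frobInner_sub_left, frobInner_sub_right]
  rw [frobInner_comm Z X]
  linarith

theorem IsSVD.isSingularBases {n₁ n₂ : ℕ} {X : Matrix (Fin n₁) (Fin n₂) ℝ}
    {U : Matrix (Fin n₁) (Fin n₁) ℝ} {V : Matrix (Fin n₂) (Fin n₂) ℝ}
    (hX : IsSVD X U V (sing X)) (ε : ℝ) : IsSingularBases X ε U V := by
  have key : ∀ {n₁ n₂ : ℕ} {Y : Matrix (Fin n₁) (Fin n₂) ℝ} {U : Matrix (Fin n₁) (Fin n₁) ℝ}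
      {V : Matrix (Fin n₂) (Fin n₂) ℝ} {s : ℕ → ℝ}, IsSVD Y U V s → ∀ (i : Fin n₁) (j : Fin n₂),
      (i : ℕ) = j → Y *ᵥ V.col j = s i • U.col i := by
    intro n₁ n₂ Y U V s h i j hij
    have h1 : Y * V = U * rectDiag n₁ n₂ s := by
      conv_lhs => rw [h.eq]
      rw [Matrix.mul_assoc, transpose_mul_of_mem h.right_orthogonal, Matrix.mul_one]
    ext k
    have h2 : (Y *ᵥ V.col j) k = (Y * V) k j := rfl
    rw [h2, h1, Matrix.mul_apply, Finset.sum_eq_single i]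
    · simp [rectDiag, hij, mul_comm]
    · intro l _ hl
      have : (l : ℕ) ≠ j := fun e => hl (Fin.ext (e.trans hij.symm))
      simp [rectDiag, this]
    · simp
  refine ⟨hX.left_orthogonal, hX.right_orthogonal, fun i j hij _ => key hX i j hij,
    fun i j hij _ => ?_⟩
  rw [key hX.transpose j i hij.symm, hij]

/-- Shows that the minorant of `IsSVD.le_Flr` and the quadratic majorant have the same linear part.
-/
theorem IsSVD.Wlr_self {n₁ n₂ : ℕ} {X : Matrix (Fin n₁) (Fin n₂) ℝ}
    {U : Matrix (Fin n₁) (Fin n₁) ℝ} {V : Matrix (Fin n₂) (Fin n₂) ℝ}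
    (hX : IsSVD X U V (sing X)) (ε : ℝ) :
    Wlr X ε U V X = U * rectDiag n₁ n₂ (fun i => wt ε (sing X i) ^ 2 * sing X i) * Vᵀ := by
  have h1 : Uᵀ * X * V = rectDiag n₁ n₂ (sing X) := by
    conv_lhs => rw [hX.eq]
    rw [← Matrix.mul_assoc, ← Matrix.mul_assoc, transpose_mul_of_mem hX.left_orthogonal,
      Matrix.one_mul, Matrix.mul_assoc, transpose_mul_of_mem hX.right_orthogonal, Matrix.mul_one]
  have h2 : Wlr X ε U V X = U * (sigmaInv X ε n₁ * (Uᵀ * X * V) * sigmaInv X ε n₂) * Vᵀ := by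
    rw [Wlr]; simp only [Matrix.mul_assoc]
  have h3 : sigmaInv X ε n₁ * rectDiag n₁ n₂ (sing X) * sigmaInv X ε n₂
      = rectDiag n₁ n₂ (fun i => wt ε (sing X i) ^ 2 * sing X i) := by
    refine (congrArg (· * sigmaInv X ε n₂)
      (diagonal_mul_rectDiag (fun i => wt ε (sing X i)) (sing X))).trans ?_
    refine (rectDiag_mul_diagonal (fun i => wt ε (sing X i)) _).trans ?_
    congr 1
    ext i
    ring
  rw [h2, h1, h3]

/-! ### The row-sparsity objective -/

theorem rowNorm_nonneg {n₁ n₂ : ℕ} (X : Matrix (Fin n₁) (Fin n₂) ℝ) (i : Fin n₁) :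
    0 ≤ rowNorm X i :=
  norm_nonneg _

theorem sum_mul_self_row {n₁ n₂ : ℕ} (X : Matrix (Fin n₁) (Fin n₂) ℝ) (i : Fin n₁) :
    ∑ j, X i j * X i j = rowNorm X i ^ 2 := by
  rw [rowNorm, EuclideanSpace.real_norm_sq_eq]
  exact Finset.sum_congr rfl fun j _ => (sq _).symm

theorem sum_mul_row_le {n₁ n₂ : ℕ} (X Z : Matrix (Fin n₁) (Fin n₂) ℝ) (i : Fin n₁) :
    ∑ j, X i j * Z i j ≤ rowNorm X i * rowNorm Z i := by
  have h := real_inner_le_norm (WithLp.toLp 2 (X i)) (WithLp.toLp 2 (Z i))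
  rw [PiLp.inner_apply] at h
  simpa [mul_comm, rowNorm] using h

theorem frobInner_Wsp_mul {n₁ n₂ : ℕ} (X A B : Matrix (Fin n₁) (Fin n₂) ℝ) (δ : ℝ) :
    frobInner A (Wsp X δ * B)
      = ∑ i, (max (rowNorm X i ^ 2 / δ ^ 2) 1)⁻¹ * ∑ j, A i j * B i j := by
  refine Finset.sum_congr rfl fun i _ => ?_
  rw [Finset.mul_sum]
  refine Finset.sum_congr rfl fun j _ => ?_
  rw [Wsp, Matrix.diagonal_mul]
  ring

theorem inv_max_sq_eq_wt {δ t : ℝ} (hδ : 0 < δ) (ht : 0 ≤ t) :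
    (max (t ^ 2 / δ ^ 2) 1)⁻¹ = wt δ t ^ 2 := by
  rw [wt, inv_pow, ← div_pow, inv_inj]
  rcases le_total (t / δ) 1 with h | h
  · rw [max_eq_right h, max_eq_right (pow_le_one₀ (by positivity) h), one_pow]
  · rw [max_eq_left h, max_eq_left (one_le_pow₀ h)]

theorem isWeight_Wsp {n₁ n₂ : ℕ} (X : Matrix (Fin n₁) (Fin n₂) ℝ) (δ : ℝ) :
    IsWeight (fun Z : Matrix (Fin n₁) (Fin n₂) ℝ => Wsp X δ * Z) 1 where
  map_add A B := Matrix.mul_add _ _ _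
  map_smul c A := Matrix.mul_smul _ _ _
  symm A B := by
    rw [frobInner_comm _ B, frobInner_Wsp_mul, frobInner_Wsp_mul]
    simp only [mul_comm]
  nonneg A := by
    rw [frobInner_Wsp_mul]
    exact Finset.sum_nonneg fun i _ => mul_nonneg (by positivity)
      (Finset.sum_nonneg fun j _ => mul_self_nonneg _)
  le A := by
    rw [frobInner_Wsp_mul, one_mul]
    exact Finset.sum_le_sum fun i _ => mul_le_of_le_one_left
      (Finset.sum_nonneg fun j _ => mul_self_nonneg _) (inv_le_one_of_one_le₀ (le_max_right _ _))

theorem Fsp_le {n₁ n₂ : ℕ} {δ : ℝ} (hδ : 0 < δ) (X Z : Matrix (Fin n₁) (Fin n₂) ℝ) :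
    Fsp δ Z ≤ Fsp δ X + 1 / 2 * frobInner Z (Wsp X δ * Z) - 1 / 2 * frobInner X (Wsp X δ * X) := by
  simp only [Fsp, frobInner_Wsp_mul, sum_mul_self_row, Finset.mul_sum, ← Finset.sum_add_distrib,
    ← Finset.sum_sub_distrib]
  refine Finset.sum_le_sum fun i _ => ?_
  have hw := wt_pos δ (rowNorm X i)
  have h1 := fSmooth_le hδ (rowNorm_nonneg Z i) (pow_pos hw 2)
    (pow_le_one₀ hw.le (wt_le_one _ _))
  have h2 := fSmooth_eq_wt hδ (rowNorm_nonneg X i)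
  rw [Real.log_pow] at h1
  push_cast at h1
  rw [inv_max_sq_eq_wt hδ (rowNorm_nonneg X i)]
  linarith

theorem le_Fsp {n₁ n₂ : ℕ} {δ : ℝ} (hδ : 0 < δ) (X Z : Matrix (Fin n₁) (Fin n₂) ℝ) :
    Fsp δ X + frobInner (Wsp X δ * X) (Z - X) - frobInner (Z - X) (Z - X) ≤ Fsp δ Z := by
  have h0 : frobInner (Z - X) (Z - X)
      = ∑ i, (rowNorm Z i ^ 2 - 2 * ∑ j, Z i j * X i j + rowNorm X i ^ 2) := by
    refine Finset.sum_congr rfl fun i _ => ?_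
    rw [← sum_mul_self_row, ← sum_mul_self_row, Finset.mul_sum, ← Finset.sum_sub_distrib,
      ← Finset.sum_add_distrib]
    refine Finset.sum_congr rfl fun j _ => ?_
    rw [Matrix.sub_apply]
    ring
  rw [frobInner_sub_right, frobInner_comm _ Z, frobInner_comm _ X, h0]
  simp only [Fsp, frobInner_Wsp_mul, ← Finset.sum_add_distrib, ← Finset.sum_sub_distrib]
  refine Finset.sum_le_sum fun i _ => ?_
  rw [sum_mul_self_row, inv_max_sq_eq_wt hδ (rowNorm_nonneg X i)]
  have h1 := le_fSmooth hδ (rowNorm_nonneg X i) (rowNorm_nonneg Z i)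
  -- Cauchy-Schwarz in one row; `wt ^ 2` comes from the linear term and `2` from the expanded
  -- square.
  have h2 := mul_le_mul_of_nonneg_left (sum_mul_row_le Z X i)
    (by positivity : 0 ≤ wt δ (rowNorm X i) ^ 2 + 2)
  nlinarith

/-! ### Quadratic majorizers -/

section Majorizer

variable {n₁ n₂ : ℕ} {T : Matrix (Fin n₁) (Fin n₂) ℝ → Matrix (Fin n₁) (Fin n₂) ℝ} {C : ℝ}
  {G : Matrix (Fin n₁) (Fin n₂) ℝ → ℝ} {X : Matrix (Fin n₁) (Fin n₂) ℝ}

/-- The quadratic `Z ↦ G X + ⟨Z, T Z⟩ / 2 - ⟨X, T X⟩ / 2` majorizes `G`. -/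
def IsMajorizer (G : Matrix (Fin n₁) (Fin n₂) ℝ → ℝ)
    (T : Matrix (Fin n₁) (Fin n₂) ℝ → Matrix (Fin n₁) (Fin n₂) ℝ)
    (X : Matrix (Fin n₁) (Fin n₂) ℝ) : Prop :=
  ∀ Z, G Z ≤ G X + 1 / 2 * frobInner Z (T Z) - 1 / 2 * frobInner X (T X)

theorem IsWeight.frobInner_add_smul (hT : IsWeight T C) (X D : Matrix (Fin n₁) (Fin n₂) ℝ)
    (t : ℝ) : frobInner (X + t • D) (T (X + t • D))
      = frobInner X (T X) + 2 * t * frobInner (T X) D + t ^ 2 * frobInner D (T D) := by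
  rw [hT.map_add, hT.map_smul]
  simp only [frobInner_add_left, frobInner_add_right, frobInner_smul_left, frobInner_smul_right]
  rw [hT.symm X D, frobInner_comm D (T X)]
  ring

theorem IsWeight.frobInner_add (hT : IsWeight T C) (X D : Matrix (Fin n₁) (Fin n₂) ℝ) :
    frobInner (X + D) (T (X + D))
      = frobInner X (T X) + 2 * frobInner (T X) D + frobInner D (T D) := by
  simpa using hT.frobInner_add_smul X D 1

/-- Cauchy-Schwarz for the semi-inner product of `T`, proved by the discriminant. -/
theorem IsWeight.abs_frobInner_le (hT : IsWeight T C) (hC : 0 ≤ C)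
    (A B : Matrix (Fin n₁) (Fin n₂) ℝ) : |frobInner (T A) B| ≤ C * (‖A‖ * ‖B‖) := by
  have h1 : discrim (frobInner B (T B)) (2 * frobInner (T A) B) (frobInner A (T A)) ≤ 0 :=
    discrim_le_zero fun t => by
      have := hT.nonneg (A + t • B)
      rw [hT.frobInner_add_smul] at this
      linarith
  have h2 : frobInner A (T A) * frobInner B (T B) ≤ (C * ‖A‖ ^ 2) * (C * ‖B‖ ^ 2) := by
    rw [← frobInner_self, ← frobInner_self]
    exact mul_le_mul (hT.le A) (hT.le B) (hT.nonneg B)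
      (mul_nonneg hC (frobInner_self_nonneg A))
  rw [discrim] at h1
  refine abs_le_of_sq_le_sq ?_ (by positivity)
  nlinarith

theorem IsMajorizer.le (hG : IsMajorizer G T X) (hT : IsWeight T C)
    (Z : Matrix (Fin n₁) (Fin n₂) ℝ) :
    G Z ≤ G X + frobInner (T X) (Z - X) + 1 / 2 * frobInner (Z - X) (T (Z - X)) := by
  have h1 := hG Z
  have h2 := hT.frobInner_add X (Z - X)
  rw [add_sub_cancel] at h2
  linarith

theorem IsMajorizer.add {G' : Matrix (Fin n₁) (Fin n₂) ℝ → ℝ}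
    {T' : Matrix (Fin n₁) (Fin n₂) ℝ → Matrix (Fin n₁) (Fin n₂) ℝ} (hG : IsMajorizer G T X)
    (hG' : IsMajorizer G' T' X) :
    IsMajorizer (fun Z => G Z + G' Z) (fun Z => T Z + T' Z) X := fun Z => by
  have h1 := hG Z
  have h2 := hG' Z
  simp only [frobInner_add_right]
  linarith

/-- `G` lies between two quadratics that agree at `X` to first order, so its deviation from the
linear part is at most `‖Z - X‖ ^ 2`. -/
theorem IsMajorizer.differentiableAt (hG : IsMajorizer G T X) (hT : IsWeight T 1)
    (hlow : ∀ Z, G X + frobInner (T X) (Z - X) - frobInner (Z - X) (Z - X) ≤ G Z) :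
    DifferentiableAt ℝ G X := by
  let ℓ : Matrix (Fin n₁) (Fin n₂) ℝ →ₗ[ℝ] ℝ :=
    { toFun := frobInner (T X)
      map_add' := frobInner_add_right _
      map_smul' := fun c A => frobInner_smul_right c _ A }
  refine (HasFDerivAt.of_isLittleO (f' := LinearMap.toContinuousLinearMap ℓ) ?_).differentiableAt
  refine Asymptotics.IsBigO.trans_isLittleO ?_
    (Asymptotics.isLittleO_pow_sub_sub X one_lt_two)
  refine Asymptotics.IsBigO.of_bound 1 (Eventually.of_forall fun Z => ?_)
  have h1 := hlow Z
  have h2 := hG.le hT Z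
  have h3 := hT.le (Z - X)
  have h4 := frobInner_self (Z - X)
  change ‖G Z - G X - frobInner (T X) (Z - X)‖ ≤ 1 * ‖‖Z - X‖ ^ 2‖
  rw [Real.norm_eq_abs, abs_le, norm_pow, norm_norm, ← h4]
  constructor <;> nlinarith [frobInner_self_nonneg (Z - X)]

/-- The difference of the two sides has a maximum at `t = 0`. A one-sided bound is enough once
differentiability is known; this serves both for the gradient formula and for stationarity. -/
theorem fderiv_eq_of_forall_le (hG : DifferentiableAt ℝ G X) {D : Matrix (Fin n₁) (Fin n₂) ℝ}
    {b c : ℝ} (h : ∀ t : ℝ, G (X + t • D) ≤ G X + t * b + t ^ 2 * c) : fderiv ℝ G X D = b := by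
  have h1 : HasDerivAt (fun t : ℝ => G (X + t • D)) (fderiv ℝ G X D) 0 :=
    hG.hasFDerivAt.hasLineDerivAt D
  have h2 : HasDerivAt (fun t : ℝ => G (X + t • D) - (t * b + t ^ 2 * c))
      (fderiv ℝ G X D - (1 * b + (2 : ℕ) * (0 : ℝ) ^ (2 - 1) * c)) 0 :=
    h1.sub (((hasDerivAt_id' (0 : ℝ)).mul_const b).add ((hasDerivAt_pow 2 (0 : ℝ)).mul_const c))
  have h3 : IsLocalMax (fun t : ℝ => G (X + t • D) - (t * b + t ^ 2 * c)) 0 :=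
    Eventually.of_forall fun t => by
      have := h t
      simp only [zero_smul, add_zero]
      linarith
  have h4 := h3.hasDerivAt_eq_zero h2
  simp at h4
  linarith

theorem IsMajorizer.fderiv_apply (hG : IsMajorizer G T X) (hT : IsWeight T C)
    (hd : DifferentiableAt ℝ G X) (D : Matrix (Fin n₁) (Fin n₂) ℝ) :
    fderiv ℝ G X D = frobInner (T X) D :=
  fderiv_eq_of_forall_le (c := 1 / 2 * frobInner D (T D)) hd fun t => by
    have h1 := hG (X + t • D)
    rw [hT.frobInner_add_smul] at h1
    linarith

theorem frobInner_matGrad (G : Matrix (Fin n₁) (Fin n₂) ℝ → ℝ)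
    (X D : Matrix (Fin n₁) (Fin n₂) ℝ) : frobInner (matGrad G X) D = fderiv ℝ G X D := by
  conv_rhs => rw [Matrix.matrix_eq_sum_single D]
  simp only [map_sum, frobInner, matGrad, Matrix.of_apply]
  refine Finset.sum_congr rfl fun i _ => Finset.sum_congr rfl fun j _ => ?_
  have : Matrix.single i j (D i j) = D i j • Matrix.single i j (1 : ℝ) := by
    rw [Matrix.smul_single, smul_eq_mul, mul_one]
  rw [this, map_smul, smul_eq_mul, mul_comm]

end Majorizer

/-! ### The two objectives together -/

/-- Differentiability does not depend on the choice of bases, so a full singular value decomposition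
may be used; the minorant is available only there. -/
theorem differentiableAt_Flr {n₁ n₂ : ℕ} {ε : ℝ} (hε : 0 < ε) (X : Matrix (Fin n₁) (Fin n₂) ℝ) :
    DifferentiableAt ℝ (Flr ε) X := by
  obtain ⟨U, V, hX⟩ := exists_isSVD X
  refine IsMajorizer.differentiableAt (T := Wlr X ε U V) (fun Z => ?_)
    (hX.isSingularBases ε).isWeight fun Z => ?_
  · exact (hX.isSingularBases ε).Flr_le hε Z
  · rw [hX.Wlr_self]
    exact hX.le_Flr hε Z

theorem differentiableAt_Fsp {n₁ n₂ : ℕ} {δ : ℝ} (hδ : 0 < δ) (X : Matrix (Fin n₁) (Fin n₂) ℝ) :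
    DifferentiableAt ℝ (Fsp δ) X :=
  IsMajorizer.differentiableAt (fun Z => Fsp_le hδ X Z) (isWeight_Wsp X δ) fun Z => le_Fsp hδ X Z

theorem differentiableAt_F {n₁ n₂ : ℕ} {ε δ : ℝ} (hε : 0 < ε) (hδ : 0 < δ)
    (X : Matrix (Fin n₁) (Fin n₂) ℝ) : DifferentiableAt ℝ (F ε δ) X :=
  (differentiableAt_Flr hε X).add (differentiableAt_Fsp hδ X)

theorem IsSingularBases.isWeight_W {n₁ n₂ : ℕ} {X : Matrix (Fin n₁) (Fin n₂) ℝ} {ε : ℝ}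
    {U : Matrix (Fin n₁) (Fin n₁) ℝ} {V : Matrix (Fin n₂) (Fin n₂) ℝ}
    (h : IsSingularBases X ε U V) (δ : ℝ) : IsWeight (W X ε δ U V) 2 := by
  have := h.isWeight.add (isWeight_Wsp X δ)
  rwa [one_add_one_eq_two] at this

theorem IsSingularBases.isMajorizer_F {n₁ n₂ : ℕ} {X : Matrix (Fin n₁) (Fin n₂) ℝ} {ε δ : ℝ}
    {U : Matrix (Fin n₁) (Fin n₁) ℝ} {V : Matrix (Fin n₂) (Fin n₂) ℝ}
    (h : IsSingularBases X ε U V) (hε : 0 < ε) (hδ : 0 < δ) :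
    IsMajorizer (F ε δ) (W X ε δ U V) X :=
  IsMajorizer.add (fun Z => h.Flr_le hε Z) fun Z => Fsp_le hδ X Z

theorem IsSingularBases.F_le_Q {n₁ n₂ : ℕ} {X : Matrix (Fin n₁) (Fin n₂) ℝ} {ε δ : ℝ}
    {U : Matrix (Fin n₁) (Fin n₁) ℝ} {V : Matrix (Fin n₂) (Fin n₂) ℝ}
    (h : IsSingularBases X ε U V) (hε : 0 < ε) (hδ : 0 < δ) (Z : Matrix (Fin n₁) (Fin n₂) ℝ) :
    F ε δ Z ≤ Qlr X ε U V Z + Qsp X δ Z := by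
  have h1 : IsMajorizer (Flr ε) (Wlr X ε U V) X := fun Z => h.Flr_le hε Z
  have h2 : IsMajorizer (Fsp δ) (fun Z => Wsp X δ * Z) X := fun Z => Fsp_le hδ X Z
  have h3 := h1.le h.isWeight Z
  have h4 := h2.le (isWeight_Wsp X δ) Z
  rw [← h1.fderiv_apply h.isWeight (differentiableAt_Flr hε X), ← frobInner_matGrad] at h3
  rw [← h2.fderiv_apply (isWeight_Wsp X δ) (differentiableAt_Fsp hδ X), ← frobInner_matGrad] at h4
  exact add_le_add h3 h4

theorem Flr_mono {n₁ n₂ : ℕ} {ε ε' : ℝ} (hε : 0 ≤ ε) (h : ε ≤ ε')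
    (X : Matrix (Fin n₁) (Fin n₂) ℝ) : Flr ε X ≤ Flr ε' X :=
  Finset.sum_le_sum fun i _ => fSmooth_mono hε h (sing_nonneg X i)

theorem Fsp_mono {n₁ n₂ : ℕ} {δ δ' : ℝ} (hδ : 0 ≤ δ) (h : δ ≤ δ')
    (X : Matrix (Fin n₁) (Fin n₂) ℝ) : Fsp δ X ≤ Fsp δ' X :=
  Finset.sum_le_sum fun i _ => fSmooth_mono hδ h (rowNorm_nonneg X i)

theorem Flr_nonneg {n₁ n₂ : ℕ} {ε : ℝ} (hε : 0 ≤ ε) (X : Matrix (Fin n₁) (Fin n₂) ℝ) :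
    0 ≤ Flr ε X :=
  Finset.sum_nonneg fun i _ => fSmooth_nonneg hε (sing_nonneg X i)

theorem F_mono {n₁ n₂ : ℕ} {ε ε' δ δ' : ℝ} (hε : 0 ≤ ε) (h : ε ≤ ε') (hδ : 0 ≤ δ) (h' : δ ≤ δ')
    (X : Matrix (Fin n₁) (Fin n₂) ℝ) : F ε δ X ≤ F ε' δ' X :=
  add_le_add (Flr_mono hε h X) (Fsp_mono hδ h' X)

theorem fSmooth_rowNorm_le_F {n₁ n₂ : ℕ} {ε δ : ℝ} (hε : 0 ≤ ε) (hδ : 0 ≤ δ)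
    (X : Matrix (Fin n₁) (Fin n₂) ℝ) (i : Fin n₁) : fSmooth δ (rowNorm X i) ≤ F ε δ X :=
  (Finset.single_le_sum (f := fun i => fSmooth δ (rowNorm X i))
    (fun i _ => fSmooth_nonneg hδ (rowNorm_nonneg X i)) (Finset.mem_univ i)).trans
    (le_add_of_nonneg_left (Flr_nonneg hε X))

theorem F_nonneg {n₁ n₂ : ℕ} {ε δ : ℝ} (hε : 0 ≤ ε) (hδ : 0 ≤ δ)
    (X : Matrix (Fin n₁) (Fin n₂) ℝ) : 0 ≤ F ε δ X :=
  add_nonneg (Flr_nonneg hε X)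
    (Finset.sum_nonneg fun i _ => fSmooth_nonneg hδ (rowNorm_nonneg X i))

/-- The majorant at `X` gives a local Lipschitz bound that does not involve `ε` or `δ`, as needed
when the smoothing parameters vary along the sequence. -/
theorem F_sub_le {n₁ n₂ : ℕ} {ε δ : ℝ} (hε : 0 < ε) (hδ : 0 < δ)
    (X Z : Matrix (Fin n₁) (Fin n₂) ℝ) :
    F ε δ Z - F ε δ X ≤ 2 * (‖X‖ * ‖Z - X‖) + ‖Z - X‖ ^ 2 := by
  obtain ⟨U, V, hX⟩ := exists_isSVD X
  have hb := hX.isSingularBases ε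
  have h1 := (hb.isMajorizer_F hε hδ).le (hb.isWeight_W δ) Z
  have h2 := (hb.isWeight_W δ).le (Z - X)
  have h3 := (abs_le.1 ((hb.isWeight_W δ).abs_frobInner_le two_pos.le X (Z - X))).2
  rw [frobInner_self] at h2
  linarith

theorem abs_F_sub_le {n₁ n₂ : ℕ} {ε δ : ℝ} (hε : 0 < ε) (hδ : 0 < δ)
    (X Z : Matrix (Fin n₁) (Fin n₂) ℝ) :
    |F ε δ Z - F ε δ X| ≤ 2 * ((‖X‖ + ‖Z‖) * ‖Z - X‖) + ‖Z - X‖ ^ 2 := by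
  have h1 := F_sub_le hε hδ X Z
  have h2 := F_sub_le hε hδ Z X
  rw [norm_sub_rev] at h2
  have h3 : 0 ≤ ‖X‖ * ‖Z - X‖ := by positivity
  have h4 : 0 ≤ ‖Z‖ * ‖Z - X‖ := by positivity
  rw [abs_le]
  constructor <;> linarith

/-- The change of matrix is controlled uniformly in the parameters; the change of parameters is then
needed only at the fixed matrix `Y₀`. -/
theorem tendsto_F {n₁ n₂ : ℕ} {ι : Type*} {l : Filter ι} {ε δ : ι → ℝ} {ε₀ δ₀ : ℝ}
    {Y : ι → Matrix (Fin n₁) (Fin n₂) ℝ} {Y₀ : Matrix (Fin n₁) (Fin n₂) ℝ} (hε₀ : 0 < ε₀)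
    (hδ₀ : 0 < δ₀) (hε : Tendsto ε l (𝓝 ε₀)) (hδ : Tendsto δ l (𝓝 δ₀))
    (hY : Tendsto Y l (𝓝 Y₀)) :
    Tendsto (fun k => F (ε k) (δ k) (Y k)) l (𝓝 (F ε₀ δ₀ Y₀)) := by
  have h1 : Tendsto (fun k => F (ε k) (δ k) Y₀) l (𝓝 (F ε₀ δ₀ Y₀)) :=
    (tendsto_finsetSum _ fun i _ => tendsto_fSmooth hε₀ (sing_nonneg Y₀ i) hε).add
      (tendsto_finsetSum _ fun i _ => tendsto_fSmooth hδ₀ (rowNorm_nonneg Y₀ i) hδ)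
  have hn : Tendsto (fun k => ‖Y k - Y₀‖) l (𝓝 0) := tendsto_iff_norm_sub_tendsto_zero.1 hY
  have hb : Tendsto (fun k => 2 * ((‖Y₀‖ + ‖Y k‖) * ‖Y k - Y₀‖) + ‖Y k - Y₀‖ ^ 2) l (𝓝 0) := by
    have := (((hY.norm.const_add ‖Y₀‖).mul hn).const_mul 2).add (hn.pow 2)
    simpa using this
  have h2 : Tendsto (fun k => F (ε k) (δ k) (Y k) - F (ε k) (δ k) Y₀) l (𝓝 0) := by
    refine squeeze_zero_norm' ?_ hb
    filter_upwards [hε.eventually (eventually_gt_nhds hε₀), hδ.eventually (eventually_gt_nhds hδ₀)]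
      with k hk hk'
    exact abs_F_sub_le hk hk' Y₀ (Y k)
  simpa using h2.add h1

/-! ### Weighted least squares -/

theorem IsWLSSolution.frobInner_eq_zero {n₁ n₂ m : ℕ}
    {A : Matrix (Fin n₁) (Fin n₂) ℝ →ₗ[ℝ] (Fin m → ℝ)} {y : Fin m → ℝ}
    {T : Matrix (Fin n₁) (Fin n₂) ℝ → Matrix (Fin n₁) (Fin n₂) ℝ} {C : ℝ}
    {X : Matrix (Fin n₁) (Fin n₂) ℝ} (h : IsWLSSolution A y T X) (hT : IsWeight T C)
    {D : Matrix (Fin n₁) (Fin n₂) ℝ} (hD : A D = 0) : frobInner (T X) D = 0 := by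
  -- The increment of the energy along `X + t • D` is a nonnegative quadratic in `t` without
  -- constant term, so its linear coefficient vanishes.
  have h1 : discrim (frobInner D (T D)) (2 * frobInner (T X) D) 0 ≤ 0 :=
    discrim_le_zero fun t => by
      have := h.2 (X + t • D) (by rw [map_add, map_smul, hD, smul_zero, add_zero, h.1])
      rw [hT.frobInner_add_smul] at this
      linarith
  rw [discrim] at h1
  have h2 : frobInner (T X) D ^ 2 ≤ 0 := by nlinarith
  exact pow_eq_zero_iff two_ne_zero |>.1 (le_antisymm h2 (sq_nonneg _))

theorem rowNormSorted_nonneg {n₁ n₂ : ℕ} (X : Matrix (Fin n₁) (Fin n₂) ℝ) (s : ℕ) :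
    0 ≤ rowNormSorted X s := by
  rw [rowNormSorted, List.getD_eq_getElem?_getD]
  cases h : (((Finset.univ : Finset (Fin n₁)).val.map (rowNorm X)).sort (· ≥ ·))[s]? with
  | none => simp
  | some a =>
    have h1 := List.mem_of_getElem? h
    rw [Multiset.mem_sort, Multiset.mem_map] at h1
    obtain ⟨i, -, rfl⟩ := h1
    exact rowNorm_nonneg X i

/-! ### The algorithm -/

namespace IsIRLSSequence

variable {n₁ n₂ m : ℕ} {A : Matrix (Fin n₁) (Fin n₂) ℝ →ₗ[ℝ] (Fin m → ℝ)} {y : Fin m → ℝ}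
  {r s : ℕ} {X : ℕ → Matrix (Fin n₁) (Fin n₂) ℝ} {ε δ : ℕ → ℝ}
  {U : ℕ → Matrix (Fin n₁) (Fin n₁) ℝ} {V : ℕ → Matrix (Fin n₂) (Fin n₂) ℝ}

theorem eps_nonneg (h : IsIRLSSequence A y r s X ε δ U V) {k : ℕ} (hk : 1 ≤ k) : 0 ≤ ε k := by
  induction k, hk using Nat.le_induction with
  | base => rw [h.eps_one]; exact sing_nonneg _ _
  | succ k hk ih => rw [h.eps_succ k hk]; exact le_min ih (sing_nonneg _ _)

theorem delta_nonneg (h : IsIRLSSequence A y r s X ε δ U V) {k : ℕ} (hk : 1 ≤ k) : 0 ≤ δ k := by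
  induction k, hk using Nat.le_induction with
  | base => rw [h.delta_one]; exact rowNormSorted_nonneg _ _
  | succ k hk ih => rw [h.delta_succ k hk]; exact le_min ih (rowNormSorted_nonneg _ _)

theorem eps_succ_le (h : IsIRLSSequence A y r s X ε δ U V) {k : ℕ} (hk : 1 ≤ k) :
    ε (k + 1) ≤ ε k := by
  rw [h.eps_succ k hk]; exact min_le_left _ _

theorem delta_succ_le (h : IsIRLSSequence A y r s X ε δ U V) {k : ℕ} (hk : 1 ≤ k) :
    δ (k + 1) ≤ δ k := by
  rw [h.delta_succ k hk]; exact min_le_left _ _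

theorem map_eq (h : IsIRLSSequence A y r s X ε δ U V) {k : ℕ} (hk : 1 ≤ k) (hε : 0 < ε k)
    (hδ : 0 < δ k) : A (X k) = y := by
  obtain ⟨k, rfl⟩ := Nat.exists_eq_add_of_le' hk
  rcases Nat.eq_zero_or_pos k with rfl | hk'
  · exact h.wls_one.1
  -- Feasibility of an iterate is a property of the preceding step, whose parameters are positive
  -- because they are at least the current ones.
  · exact (h.wls_succ k hk' (hε.trans_le (h.eps_succ_le hk'))
      (hδ.trans_le (h.delta_succ_le hk'))).1

theorem map_sub_eq_zero (h : IsIRLSSequence A y r s X ε δ U V) {k : ℕ} (hk : 1 ≤ k)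
    (hε : 0 < ε k) (hδ : 0 < δ k) : A (X k - X (k + 1)) = 0 := by
  rw [map_sub, h.map_eq hk hε hδ, (h.wls_succ k hk hε hδ).1, sub_self]

/-- Sufficient decrease of the objective. -/
theorem F_succ_add_le (h : IsIRLSSequence A y r s X ε δ U V) {k : ℕ} (hk : 1 ≤ k)
    (hε : 0 < ε k) (hδ : 0 < δ k) :
    F (ε (k + 1)) (δ (k + 1)) (X (k + 1)) + 1 / 2 * frobInner (X k - X (k + 1))
      (W (X k) (ε k) (δ k) (U k) (V k) (X k - X (k + 1))) ≤ F (ε k) (δ k) (X k) := by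
  have hb := h.bases k hk hε hδ
  have hw := hb.isWeight_W (δ k)
  have h1 := F_mono (h.eps_nonneg (Nat.le_add_left 1 k)) (h.eps_succ_le hk)
    (h.delta_nonneg (Nat.le_add_left 1 k)) (h.delta_succ_le hk) (X (k + 1))
  have h2 := hb.isMajorizer_F hε hδ (X (k + 1))
  -- Expanding around the new iterate makes the cross term vanish by optimality, leaving a
  -- Pythagorean identity.
  have h3 := hw.frobInner_add (X (k + 1)) (X k - X (k + 1))
  rw [(h.wls_succ k hk hε hδ).frobInner_eq_zero hw (h.map_sub_eq_zero hk hε hδ),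
    add_sub_cancel] at h3
  linarith

theorem F_succ_le (h : IsIRLSSequence A y r s X ε δ U V) {k : ℕ} (hk : 1 ≤ k)
    (hε : 0 < ε k) (hδ : 0 < δ k) :
    F (ε (k + 1)) (δ (k + 1)) (X (k + 1)) ≤ F (ε k) (δ k) (X k) := by
  have h1 := h.F_succ_add_le hk hε hδ
  have h2 := ((h.bases k hk hε hδ).isWeight_W (δ k)).nonneg (X k - X (k + 1))
  linarith

/-! ### Vanishing steps and stationarity when the smoothing parameters stay positive. -/

section Limit

variable {εbar δbar : ℝ}

theorem le_eps (h : IsIRLSSequence A y r s X ε δ U V) (hlim : Tendsto ε atTop (𝓝 εbar)) {k : ℕ}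
    (hk : 1 ≤ k) : εbar ≤ ε k := by
  obtain ⟨k, rfl⟩ := Nat.exists_eq_add_of_le' hk
  -- The index is shifted because `ε 0` is unconstrained.
  have ha : Antitone fun k => ε (k + 1) :=
    antitone_nat_of_succ_le fun k => h.eps_succ_le (Nat.le_add_left 1 k)
  exact ha.le_of_tendsto ((tendsto_add_atTop_iff_nat 1).2 hlim) k

theorem le_delta (h : IsIRLSSequence A y r s X ε δ U V) (hlim : Tendsto δ atTop (𝓝 δbar)) {k : ℕ}
    (hk : 1 ≤ k) : δbar ≤ δ k := by
  obtain ⟨k, rfl⟩ := Nat.exists_eq_add_of_le' hk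
  have ha : Antitone fun k => δ (k + 1) :=
    antitone_nat_of_succ_le fun k => h.delta_succ_le (Nat.le_add_left 1 k)
  exact ha.le_of_tendsto ((tendsto_add_atTop_iff_nat 1).2 hlim) k

theorem antitone_F (h : IsIRLSSequence A y r s X ε δ U V) (hε : ∀ k, 1 ≤ k → 0 < ε k)
    (hδ : ∀ k, 1 ≤ k → 0 < δ k) :
    Antitone fun k => F (ε (k + 1)) (δ (k + 1)) (X (k + 1)) :=
  antitone_nat_of_succ_le fun k =>
    h.F_succ_le (Nat.le_add_left 1 k) (hε _ (Nat.le_add_left 1 k)) (hδ _ (Nat.le_add_left 1 k))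

/-- The sparsity part of the weight alone is coercive: the objective never exceeds its first value,
which bounds all row norms and so keeps every diagonal weight above a fixed positive constant. -/
theorem norm_sub_sq_le (h : IsIRLSSequence A y r s X ε δ U V) (hε : ∀ k, 1 ≤ k → 0 < ε k)
    (hδbar : 0 < δbar) (hδ : ∀ k, 1 ≤ k → δbar ≤ δ k) (k : ℕ) :
    ‖X (k + 1) - X (k + 2)‖ ^ 2 ≤ 2 * Real.exp (2 * F (ε 1) (δ 1) (X 1) / δbar ^ 2) *
      (F (ε (k + 1)) (δ (k + 1)) (X (k + 1)) - F (ε (k + 2)) (δ (k + 2)) (X (k + 2))) := by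
  have hk : 1 ≤ k + 1 := Nat.le_add_left 1 k
  have hδ' : ∀ k, 1 ≤ k → 0 < δ k := fun k hk => hδbar.trans_le (hδ k hk)
  set B := Real.exp (2 * F (ε 1) (δ 1) (X 1) / δbar ^ 2) with hB
  have hB0 : 0 < B := Real.exp_pos _
  have hmax : ∀ i, max (rowNorm (X (k + 1)) i ^ 2 / δ (k + 1) ^ 2) 1 ≤ B := fun i => by
    -- Passing from `δ (k + 1)` down to `δbar` makes the constant `B` independent of `k`.
    have h1 : fSmooth δbar (rowNorm (X (k + 1)) i) ≤ F (ε 1) (δ 1) (X 1) :=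
      (fSmooth_mono hδbar.le (hδ _ hk) (rowNorm_nonneg _ i)).trans
        ((fSmooth_rowNorm_le_F (hε _ hk).le (hδ' _ hk).le _ i).trans
          (h.antitone_F hε hδ' (Nat.zero_le k)))
    have h2 := hδ _ hk
    calc max (rowNorm (X (k + 1)) i ^ 2 / δ (k + 1) ^ 2) 1
        ≤ max (rowNorm (X (k + 1)) i ^ 2 / δbar ^ 2) 1 := by gcongr
      _ ≤ Real.exp (2 * fSmooth δbar (rowNorm (X (k + 1)) i) / δbar ^ 2) :=
          max_sq_div_le_exp hδbar (rowNorm_nonneg _ i)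
      _ ≤ B := by rw [hB]; gcongr
  set D := X (k + 1) - X (k + 2) with hD
  have h1 := h.F_succ_add_le hk (hε _ hk) (hδ' _ hk)
  have h2 : B⁻¹ * ‖D‖ ^ 2 ≤ frobInner D
      (W (X (k + 1)) (ε (k + 1)) (δ (k + 1)) (U (k + 1)) (V (k + 1)) D) := by
    rw [W, frobInner_add_right, frobInner_Wsp_mul, ← frobInner_self, frobInner, Finset.mul_sum]
    refine le_add_of_nonneg_of_le ((h.bases _ hk (hε _ hk) (hδ' _ hk)).isWeight.nonneg D)
      (Finset.sum_le_sum fun i _ => ?_)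
    refine mul_le_mul_of_nonneg_right ?_ (Finset.sum_nonneg fun j _ => mul_self_nonneg _)
    exact inv_anti₀ (lt_of_lt_of_le one_pos (le_max_right _ _)) (hmax i)
  have h3 : B⁻¹ * ‖D‖ ^ 2
      ≤ 2 * (F (ε (k + 1)) (δ (k + 1)) (X (k + 1)) - F (ε (k + 2)) (δ (k + 2)) (X (k + 2))) := by
    linarith
  rw [inv_mul_le_iff₀ hB0] at h3
  linarith

/-- The objective values are nonincreasing and nonnegative, hence convergent, so the consecutive
differences that bound the squared steps tend to zero. -/
theorem tendsto_norm_sub (h : IsIRLSSequence A y r s X ε δ U V) (hεbar : 0 < εbar)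
    (hδbar : 0 < δbar) (hεlim : Tendsto ε atTop (𝓝 εbar)) (hδlim : Tendsto δ atTop (𝓝 δbar)) :
    Tendsto (fun k => ‖X k - X (k + 1)‖) atTop (𝓝 0) := by
  have hε : ∀ k, 1 ≤ k → 0 < ε k := fun k hk => hεbar.trans_le (h.le_eps hεlim hk)
  have hδ : ∀ k, 1 ≤ k → 0 < δ k := fun k hk => hδbar.trans_le (h.le_delta hδlim hk)
  rw [← tendsto_add_atTop_iff_nat 1]
  have hconv := tendsto_atTop_ciInf (h.antitone_F hε hδ) ⟨0, by
    rintro _ ⟨k, rfl⟩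
    exact F_nonneg (hε _ (Nat.le_add_left 1 k)).le (hδ _ (Nat.le_add_left 1 k)).le _⟩
  have hdiff := (hconv.sub ((tendsto_add_atTop_iff_nat 1).2 hconv)).const_mul
    (2 * Real.exp (2 * F (ε 1) (δ 1) (X 1) / δbar ^ 2))
  rw [sub_self, mul_zero] at hdiff
  have hsq := squeeze_zero (fun k => sq_nonneg ‖X (k + 1) - X (k + 2)‖)
    (fun k => h.norm_sub_sq_le hε hδbar (fun k hk => h.le_delta hδlim hk) k) hdiff
  have := hsq.sqrt
  simpa using this

/-- Along a subsequence the inequality `F (X k + t Ξ) ≤ F (X k) + t ⟨W (X k), Ξ⟩ + t² ‖Ξ‖²` passes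
to the limit, and the linear coefficient is dominated by the vanishing step length. -/
theorem isStationaryPoint (h : IsIRLSSequence A y r s X ε δ U V) (hεbar : 0 < εbar)
    (hδbar : 0 < δbar) (hεlim : Tendsto ε atTop (𝓝 εbar)) (hδlim : Tendsto δ atTop (𝓝 δbar))
    {Xbar : Matrix (Fin n₁) (Fin n₂) ℝ} (hX : MapClusterPt Xbar atTop X) :
    IsStationaryPoint A y (F εbar δbar) Xbar := by
  have hε : ∀ k, 1 ≤ k → 0 < ε k := fun k hk => hεbar.trans_le (h.le_eps hεlim hk)
  have hδ : ∀ k, 1 ≤ k → 0 < δ k := fun k hk => hδbar.trans_le (h.le_delta hδlim hk)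
  have : FirstCountableTopology (Matrix (Fin n₁) (Fin n₂) ℝ) :=
    inferInstanceAs (FirstCountableTopology (Fin n₁ → Fin n₂ → ℝ))
  obtain ⟨φ, hφ, hφX⟩ := hX.tendsto_subseq
  have hφtop := hφ.tendsto_atTop
  have hφ1 : ∀ᶠ k in atTop, 1 ≤ φ k := hφtop.eventually_ge_atTop 1
  refine ⟨?_, differentiableAt_F hεbar hδbar Xbar, fun Ξ hΞ => ?_⟩
  · have hA : Continuous A := A.continuous_of_finiteDimensional
    refine tendsto_nhds_unique ((hA.tendsto Xbar).comp hφX) (tendsto_const_nhds.congr' ?_)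
    filter_upwards [hφ1] with k hk
    exact (h.map_eq hk (hε _ hk) (hδ _ hk)).symm
  · rw [frobInner_matGrad]
    -- The constant is half of the uniform bound `2` for `W`, times `‖Ξ‖ ^ 2`.
    refine fderiv_eq_of_forall_le (c := ‖Ξ‖ ^ 2) (differentiableAt_F hεbar hδbar Xbar) fun t => ?_
    have hl := tendsto_F hεbar hδbar (hεlim.comp hφtop) (hδlim.comp hφtop)
      (hφX.add_const (t • Ξ))
    have hr := (tendsto_F hεbar hδbar (hεlim.comp hφtop) (hδlim.comp hφtop) hφX).add
      ((((h.tendsto_norm_sub hεbar hδbar hεlim hδlim).comp hφtop).mul_const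
        (2 * |t| * ‖Ξ‖)).add_const (t ^ 2 * ‖Ξ‖ ^ 2))
    rw [zero_mul, zero_add] at hr
    rw [mul_zero, add_zero]
    refine le_of_tendsto_of_tendsto hl hr ?_
    filter_upwards [hφ1] with k hk
    have hb := h.bases _ hk (hε _ hk) (hδ _ hk)
    have hw := hb.isWeight_W (δ (φ k))
    have h1 := hb.isMajorizer_F (hε _ hk) (hδ _ hk) (X (φ k) + t • Ξ)
    rw [hw.frobInner_add_smul] at h1
    have h2 := hw.le Ξ
    rw [frobInner_self] at h2
    have h3 := hw.abs_frobInner_le two_pos.le (X (φ k) - X (φ k + 1)) Ξ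
    -- The weighted new iterate is orthogonal to the kernel of `A`, so the gradient at `X (φ k)` may
    -- be replaced by the weighted step, which is small.
    have h4 : frobInner (W (X (φ k)) (ε (φ k)) (δ (φ k)) (U (φ k)) (V (φ k))
        (X (φ k) - X (φ k + 1))) Ξ
        = frobInner (W (X (φ k)) (ε (φ k)) (δ (φ k)) (U (φ k)) (V (φ k)) (X (φ k))) Ξ := by
      have h5 := hw.map_add (X (φ k) - X (φ k + 1)) (X (φ k + 1))
      rw [sub_add_cancel] at h5
      rw [h5, frobInner_add_left,
        (h.wls_succ _ hk (hε _ hk) (hδ _ hk)).frobInner_eq_zero hw hΞ, add_zero]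
    rw [h4] at h3
    have h6 := le_abs_self (t * frobInner (W (X (φ k)) (ε (φ k)) (δ (φ k)) (U (φ k)) (V (φ k))
      (X (φ k))) Ξ)
    rw [abs_mul] at h6
    have h7 := mul_le_mul_of_nonneg_left h3 (abs_nonneg t)
    have h8 := mul_le_mul_of_nonneg_left h2 (sq_nonneg t)
    simp only [Function.comp_apply]
    linarith

end Limit

end IsIRLSSequence

end IRLS

theorem theorem2 {n₁ n₂ m : ℕ} (A : Matrix (Fin n₁) (Fin n₂) ℝ →ₗ[ℝ] (Fin m → ℝ))
    (y : Fin m → ℝ) (r s : ℕ) (X : ℕ → Matrix (Fin n₁) (Fin n₂) ℝ) (ε δ : ℕ → ℝ)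
    (U : ℕ → Matrix (Fin n₁) (Fin n₁) ℝ) (V : ℕ → Matrix (Fin n₂) (Fin n₂) ℝ)
    (h : IRLS.IsIRLSSequence A y r s X ε δ U V) :
    (∀ k, 1 ≤ k → 0 < ε k → 0 < δ k →
      DifferentiableAt ℝ (IRLS.Flr (ε k)) (X k) ∧ DifferentiableAt ℝ (IRLS.Fsp (δ k)) (X k) ∧
      ∀ Z : Matrix (Fin n₁) (Fin n₂) ℝ,
        IRLS.F (ε k) (δ k) Z ≤
          IRLS.Qlr (X k) (ε k) (U k) (V k) Z + IRLS.Qsp (X k) (δ k) Z) ∧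
    (∀ k, 1 ≤ k → 0 < ε k → 0 < δ k →
      IRLS.F (ε (k + 1)) (δ (k + 1)) (X (k + 1)) ≤ IRLS.F (ε k) (δ k) (X k)) ∧
    (∀ εbar δbar : ℝ, 0 < εbar → 0 < δbar →
      Tendsto ε atTop (𝓝 εbar) → Tendsto δ atTop (𝓝 δbar) →
      Tendsto (fun k => ‖X k - X (k + 1)‖) atTop (𝓝 0) ∧
      ∀ Xbar : Matrix (Fin n₁) (Fin n₂) ℝ, MapClusterPt Xbar atTop X →
        IRLS.IsStationaryPoint A y (IRLS.F εbar δbar) Xbar) :=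
  ⟨fun k hk hε hδ => ⟨IRLS.differentiableAt_Flr hε _, IRLS.differentiableAt_Fsp hδ _,
      (h.bases k hk hε hδ).F_le_Q hε hδ⟩,
    fun _ hk hε hδ => h.F_succ_le hk hε hδ,
    fun _ _ hεbar hδbar hεlim hδlim => ⟨h.tendsto_norm_sub hεbar hδbar hεlim hδlim,
      fun _ hX => h.isStationaryPoint hεbar hδbar hεlim hδlim hX⟩⟩
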